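/- Let $n\ge 1$, let $S^{2n+1}=\{z\in\mathbb C^{n+1}:|z|=1\}$ carry the contact form $\theta_0=\frac i2\sum_{j=1}^{n+1}(z_j\,d\bar z_j-\bar z_j\,dz_j)|_{S^{2n+1}}$, let $dV=\theta_0\wedge(d\theta_0)^n$ be its volume measure, $\omega_{2n+1}=\int_{S^{2n+1}}dV$ and $Q=2n+2$. Let $d$ be a CR distance associated with $\theta_0$, that is, a nonnegative symmetric continuous function on $S^{2n+1}\times S^{2n+1}$ such that $c\,d_{CC}\le d\le C\,d_{CC}$ for some constants $c,C>0$, where $d_{CC}$ is the Carnot–Carathéodory distance of $\theta_0$: the infimum of the lengths of piecewise $C^1$ curves tangent to $\ker\theta_0$, measured in the metric $|v|^2=d\theta_0(v,iv)$ on $\ker\theta_0$. (The triangle inequality for $d$ is not needed.) Let $1<p<Q$, $s\in(0,1)$ and $p^*=\frac{Qp}{Q-sp}$. For measurable $u:S^{2n+1}\to\mathbb R$ put $$[u]_{s,p}=\Bigl(\int_{S^{2n+1}}\int_{S^{2n+1}}\frac{|u(\xi)-u(\eta)|^p}{d(\xi,\eta)^{Q+sp}}\,dV(\xi)\,dV(\eta)\Bigr)^{1/p},$$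 let $HW^{s,p}(S^{2n+1})=\{u\in L^p(S^{2n+1},dV):[u]_{s,p}<\infty\}$, and let $\mathbb B_p$ be the set of all $B\in\mathbb R$ for which there is an $A\in\mathbb R$ such that $$\|u\|_{L^{p^*}(S^{2n+1})}\le A\,[u]_{s,p}+B\,\|u\|_{L^p(S^{2n+1})}\qquad\text{for all }u\in HW^{s,p}(S^{2n+1}).$$ Then $$\mathbb B_p=[\omega_{2n+1}^{-s/Q},\infty).$$ In particular, $\mathbb B_p$ is closed and its left endpoint is attained. -/

import Mathlib

open Set MeasureTheory
open scoped ENNReal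

noncomputable section

namespace CRSphere

/-- The complex Euclidean space `ℂⁿ⁺¹`. -/
abbrev Amb (n : ℕ) : Type := EuclideanSpace ℂ (Fin (n + 1))

/-- The unit sphere `S²ⁿ⁺¹ ⊂ ℂⁿ⁺¹`. -/
abbrev Sph (n : ℕ) : Type := Metric.sphere (0 : Amb n) 1

/-! ### The contact form and its exterior derivative -/

/-- The one-form `θ₀ = (i/2) ∑ⱼ (zⱼ dz̄ⱼ - z̄ⱼ dzⱼ)` on `ℂⁿ⁺¹`, that is
`θ₀(z)(v) = Im ⟨z, v⟩` (see `theta_apply_eq`). Its pull-back to the sphere is the standard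
pseudohermitian form. -/
def theta (n : ℕ) (z : Amb n) : Amb n [⋀^Fin 1]→L[ℝ] ℝ :=
  ContinuousAlternatingMap.ofSubsingleton ℝ (Amb n) ℝ (0 : Fin 1)
    (Complex.imCLM.comp ((innerSL ℂ z).restrictScalars ℝ))

/-- The two-form `dθ₀` (exterior derivative on `ℂⁿ⁺¹`; it commutes with the pull-back to the
sphere). -/
def dtheta (n : ℕ) (z : Amb n) : Amb n [⋀^Fin 2]→L[ℝ] ℝ :=
  extDeriv (theta n) z

theorem theta_apply (n : ℕ) (z v : Amb n) : theta n z ![v] = (inner ℂ z v).im := by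
  simp [theta]

theorem theta_apply_eq (n : ℕ) (z v : Amb n) :
    ((theta n z ![v] : ℝ) : ℂ) =
      Complex.I / 2 * ∑ j, (z j * starRingEnd ℂ (v j) - starRingEnd ℂ (z j) * v j) := by
  rw [theta_apply, PiLp.inner_apply, Complex.im_sum, Finset.mul_sum, Complex.ofReal_sum]
  refine Finset.sum_congr rfl fun j _ => ?_
  apply Complex.ext <;> (simp; try ring)

theorem dtheta_apply (n : ℕ) (z v w : Amb n) :
    dtheta n z ![v, w] = 2 * (inner ℂ v w).im := by
  let L : Amb n →L[ℝ] (Amb n [⋀^Fin 1]→L[ℝ] ℝ) :=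
    LinearMap.toContinuousLinearMap
      { toFun := theta n
        map_add' := fun x y => by ext u; simp [theta]
        map_smul' := fun c x => by
          ext u
          simp [theta, inner_smul_left_eq_smul] }
  have hL : HasFDerivAt (theta n) L z := L.hasFDerivAt
  rw [dtheta, extDeriv, hL.fderiv]
  have h1 : ∀ x y : Amb n, L x ![y] = (inner ℂ x y).im := fun x y => theta_apply n x y
  have h2 : (inner ℂ w v).im = -(inner ℂ v w).im := by
    rw [← inner_conj_symm, Complex.conj_im]
  have e0 : (0 : Fin 2).removeNth ![v, w] = ![w] := by ext i; fin_cases i; rfl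
  have e1 : (1 : Fin 2).removeNth ![v, w] = ![v] := by ext i; fin_cases i; rfl
  rw [ContinuousAlternatingMap.alternatizeUncurryFin_apply, Fin.sum_univ_two, e0, e1]
  simp [h1, h2]
  ring

theorem dtheta_self (n : ℕ) (z v : Amb n) :
    dtheta n z ![v, Complex.I • v] = 2 * ‖v‖ ^ 2 := by
  rw [dtheta_apply, inner_smul_right, inner_self_eq_norm_sq_to_K]
  have h : (((‖v‖ : ℝ) : ℂ) ^ 2).re = ‖v‖ ^ 2 := by norm_cast
  simpa using h

/-! ### The volume form and its measure -/

/-- The form `θ₀ ∧ (dθ₀)ⁿ` at `z`, evaluated on `2n + 1` vectors. This is the usual formula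
`(1 / (1! (2!)ⁿ)) ∑_σ sgn(σ) θ₀(v_{σ 0}) ∏ₖ dθ₀(v_{σ(2k+1)}, v_{σ(2k+2)})`
for the wedge product of a one-form and `n` two-forms, normalized so that
`(dx ∧ dy)(∂x, ∂y) = 1`. -/
def volForm (n : ℕ) (z : Amb n) (v : Fin (2 * n + 1) → Amb n) : ℝ :=
  (1 / 2 ^ n : ℝ) * ∑ σ : Equiv.Perm (Fin (2 * n + 1)),
    ((Equiv.Perm.sign σ : ℤ) : ℝ) * theta n z ![v (σ 0)] *
      ∏ k : Fin n, dtheta n z ![v (σ ⟨2 * k + 1, by omega⟩), v (σ ⟨2 * k + 2, by omega⟩)]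

/-- `v` is an orthonormal basis of the (real) tangent space of the sphere at `ξ`. -/
def IsTangentFrame (n : ℕ) (ξ : Sph n) (v : Fin (2 * n + 1) → Amb n) : Prop :=
  Orthonormal ℝ v ∧ ∀ i, inner ℝ (ξ : Amb n) (v i) = 0

/-- The density of `θ₀ ∧ (dθ₀)ⁿ` with respect to the surface measure of the sphere: the absolute
value of the form on an orthonormal tangent frame. All frames give the same value, and the
supremum over them only avoids choosing one. -/
def volDensity (n : ℕ) (ξ : Sph n) : ℝ≥0∞ :=
  ⨆ (v : Fin (2 * n + 1) → Amb n) (_ : IsTangentFrame n ξ v),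
    ENNReal.ofReal |volForm n (ξ : Amb n) v|

/-- The measure `dV_{θ₀} = θ₀ ∧ (dθ₀)ⁿ` on the sphere; `volume.toSphere` is the usual surface
measure. -/
def vol (n : ℕ) : Measure (Sph n) :=
  (volume : Measure (Amb n)).toSphere.withDensity (volDensity n)

/-- `ω_{2n+1} = ∫ dV_{θ₀}`. -/
def omega (n : ℕ) : ℝ := (vol n).real univ

/-! ### CR distances -/

/-- A piecewise `C¹` curve `[0,1] → S²ⁿ⁺¹` which is horizontal: `γ'` lies in `ker θ₀`. -/
def IsHorizontalCurve (n : ℕ) (γ : ℝ → Amb n) : Prop :=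
  ContinuousOn γ (Icc 0 1) ∧ (∀ t ∈ Icc (0 : ℝ) 1, γ t ∈ Metric.sphere (0 : Amb n) 1) ∧
    ∃ F : Finset ℝ, ∀ t ∈ Ioo (0 : ℝ) 1, t ∉ F →
      ContDiffAt ℝ 1 γ t ∧ theta n (γ t) ![deriv γ t] = 0

/-- The length of a horizontal curve for the metric `|v|² = dθ₀(v, iv)` that the Levi form of `θ₀`
induces on the horizontal bundle. -/
def horizontalLength (n : ℕ) (γ : ℝ → Amb n) : ℝ≥0∞ :=
  ∫⁻ t in Icc (0 : ℝ) 1,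
    ENNReal.ofReal (Real.sqrt (dtheta n (γ t) ![deriv γ t, Complex.I • deriv γ t]))

/-- The Carnot-Carathéodory distance of `θ₀`: the infimum of the lengths of the horizontal curves
from `ξ` to `η`. -/
def ccDist (n : ℕ) (ξ η : Sph n) : ℝ≥0∞ :=
  ⨅ (γ : ℝ → Amb n) (_ : IsHorizontalCurve n γ ∧ γ 0 = ξ ∧ γ 1 = η), horizontalLength n γ

/-- A CR distance associated with `θ₀`: a nonnegative, symmetric, continuous function on
`S²ⁿ⁺¹ × S²ⁿ⁺¹` that is comparable with the Carnot-Carathéodory distance of `θ₀`. The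
triangle inequality is not required, so that every metric equivalent to the Carnot-Carathéodory
distance and also every symmetric quasi-distance coming from a homogeneous gauge is included. -/
structure IsCRDistance (n : ℕ) (d : Sph n → Sph n → ℝ) : Prop where
  nonneg : ∀ ξ η, 0 ≤ d ξ η
  symm : ∀ ξ η, d ξ η = d η ξ
  continuous : Continuous fun q : Sph n × Sph n => d q.1 q.2
  comparable : ∃ c C : ℝ, 0 < c ∧ 0 < C ∧ ∀ ξ η,
    ENNReal.ofReal c * ccDist n ξ η ≤ ENNReal.ofReal (d ξ η) ∧
      ENNReal.ofReal (d ξ η) ≤ ENNReal.ofReal C * ccDist n ξ η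

/-! ### Fractional spaces and admissible coefficients -/

/-- The homogeneous dimension `Q = 2n + 2`. -/
def homDim (n : ℕ) : ℝ := 2 * n + 2

/-- The critical exponent `p* = Qp / (Q - sp)`. -/
def critExp (n : ℕ) (s p : ℝ) : ℝ := homDim n * p / (homDim n - s * p)

/-- The extended-real-valued seminorm `[u]_{s,p}`. -/
def eSeminorm (n : ℕ) (d : Sph n → Sph n → ℝ) (s p : ℝ) (u : Sph n → ℝ) : ℝ≥0∞ :=
  (∫⁻ η, ∫⁻ ξ, ENNReal.ofReal (|u ξ - u η| ^ p / d ξ η ^ (homDim n + s * p)) ∂(vol n) ∂(vol n))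
    ^ (1 / p)

/-- `u ∈ HW^{s,p}(S²ⁿ⁺¹)`: `u ∈ L^p` and `[u]_{s,p} < ∞`. -/
def MemHW (n : ℕ) (d : Sph n → Sph n → ℝ) (s p : ℝ) (u : Sph n → ℝ) : Prop :=
  MemLp u (ENNReal.ofReal p) (vol n) ∧ eSeminorm n d s p u < ∞

/-- The seminorm `[u]_{s,p}` as a real number (for `u ∈ HW^{s,p}`). -/
def seminorm (n : ℕ) (d : Sph n → Sph n → ℝ) (s p : ℝ) (u : Sph n → ℝ) : ℝ :=
  (eSeminorm n d s p u).toReal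

/-- The norm `‖u‖_{L^r(S²ⁿ⁺¹)}` as a real number (for `u ∈ L^r`). -/
def lpNorm (n : ℕ) (r : ℝ) (u : Sph n → ℝ) : ℝ :=
  (eLpNorm u (ENNReal.ofReal r) (vol n)).toReal

/-- The set of the `B ∈ ℝ` for which there is an `A ∈ ℝ` with
`‖u‖_{p*} ≤ A [u]_{s,p} + B ‖u‖_p` for all `u ∈ HW^{s,p}`; the inequality includes that its
left-hand side is finite. -/
def admissibleB (n : ℕ) (d : Sph n → Sph n → ℝ) (s p : ℝ) : Set ℝ :=
  {B | ∃ A : ℝ, ∀ u : Sph n → ℝ, MemHW n d s p u →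
    MemLp u (ENNReal.ofReal (critExp n s p)) (vol n) ∧
      lpNorm n (critExp n s p) u ≤ A * seminorm n d s p u + B * lpNorm n p u}

end CRSphere

end

noncomputable section

namespace CRSphere

/-! ### Horizontal curves -/

/-! Constants have zero seminorm, so testing with `u = 1` forces `B ≥ ω^(1/p* - 1/p) = ω^(-s/Q)`.
Conversely, split `u = (u - m) + m` with `m` the mean of `u`. Hölder's inequality (`abs_average_le`)
bounds `‖m‖_{p*}` by exactly `ω^(-s/Q) ‖u‖_p`, while a Sobolev–Poincaré inequality
(`exists_eLpNorm_sub_average_le`) puts `‖u - m‖_{p*}` entirely into the term `A [u]_{s,p}`. No best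
Sobolev constant is involved, so the endpoint is attained.

The Sobolev–Poincaré inequality follows from a Hedberg-type argument. Averaging over a ball of
radius comparable to `r` gives `|f(η)| ≤ K₁ r^s U(η) + K₂ r^(-Q/q) ‖f‖_q`, where `U` is the
pointwise fractional gradient and `q = p*` (`enorm_le_of_ball`). Optimizing in `r` yields `|f| ≤ E
U^(p/q) ‖f‖_q^(1-p/q)`; taking the `q`-th power and integrating, a power of `‖f‖_q` cancels.
Truncation makes that norm finite. Of the geometry this uses only that `d` is bounded and
measurable, vanishes only on the diagonal, and has balls of measure at least `c r^Q`. Neither a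
triangle inequality nor an upper volume bound enters.

The lower volume bound combines two facts about the set where `1 - |⟨ξ,η⟩|` and `|arg ⟨ξ,η⟩|` are at
most `r²`: explicit horizontal curves reach it from `ξ` within length `12 r` (`ccDist_le_of_inner`),
and the cone over it contains the image of a fixed ball under a linear map of determinant `r^(2n+2)`
(`vol_ge_of_koranyi`). -/

theorem horizontalLength_le {n : ℕ} {γ : ℝ → Amb n} {L : ℝ} {F : Finset ℝ}
    (h : ∀ t ∈ Ioo (0 : ℝ) 1, t ∉ F → ‖deriv γ t‖ ≤ L) :
    horizontalLength n γ ≤ ENNReal.ofReal (√2 * L) := by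
  have hae : ∀ᵐ t ∂(volume.restrict (Icc (0 : ℝ) 1)),
      ENNReal.ofReal (√(dtheta n (γ t) ![deriv γ t, Complex.I • deriv γ t])) ≤
        ENNReal.ofReal (√2 * L) := by
    rw [← restrict_Ioo_eq_restrict_Icc, ae_restrict_iff' measurableSet_Ioo]
    have h0 : ∀ᵐ t : ℝ, t ∉ (F : Set ℝ) :=
      measure_eq_zero_iff_ae_notMem.1 (F.finite_toSet.measure_zero _)
    filter_upwards [h0] with t ht ht'
    refine ENNReal.ofReal_le_ofReal ?_
    rw [dtheta_self, Real.sqrt_mul (by norm_num), Real.sqrt_sq (norm_nonneg _)]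
    exact mul_le_mul_of_nonneg_left (h t ht' (by simpa using ht)) (Real.sqrt_nonneg _)
  calc horizontalLength n γ ≤ ∫⁻ _ in Icc (0 : ℝ) 1, ENNReal.ofReal (√2 * L) :=
        lintegral_mono_ae hae
    _ = _ := by simp

/-- A `C¹` curve on the whole line which stays on the sphere, is horizontal and has speed at
most `L`. -/
structure IsHorizontalLine (n : ℕ) (γ : ℝ → Amb n) (L : ℝ) : Prop where
  contDiff : ContDiff ℝ 1 γ
  norm_eq : ∀ t, ‖γ t‖ = 1
  horizontal : ∀ t, (inner ℂ (γ t) (deriv γ t)).im = 0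
  speed : ∀ t, ‖deriv γ t‖ ≤ L

theorem ccDist_le_of_isHorizontalLine {n : ℕ} {γ δ : ℝ → Amb n} {L : ℝ}
    (hγ : IsHorizontalLine n γ L) (hδ : IsHorizontalLine n δ L) (h : γ 1 = δ 0) {ξ η : Sph n}
    (h0 : γ 0 = ξ) (h1 : δ 1 = η) : ccDist n ξ η ≤ ENNReal.ofReal (√2 * (2 * L)) := by
  classical
  -- Each curve is run at double speed, whence the factor 2 in the bound; the only possible corner
  -- is at `1/2`.
  set κ : ℝ → Amb n := fun t => if t ≤ 1 / 2 then γ (2 * t) else δ (2 * t - 1) with hκ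
  have c1 : ContDiff ℝ 1 fun t : ℝ => γ (2 * t) := hγ.contDiff.comp (by fun_prop)
  have c2 : ContDiff ℝ 1 fun t : ℝ => δ (2 * t - 1) := hδ.contDiff.comp (by fun_prop)
  have d1 : ∀ t : ℝ, deriv (fun t : ℝ => γ (2 * t)) t = (2 : ℝ) • deriv γ (2 * t) := by
    intro t
    have := (hγ.contDiff.differentiable (by norm_num) (2 * t)).hasDerivAt.scomp t
      ((hasDerivAt_id t).const_mul (2 : ℝ))
    simpa [Function.comp_def] using this.deriv
  have d2 : ∀ t : ℝ, deriv (fun t : ℝ => δ (2 * t - 1)) t = (2 : ℝ) • deriv δ (2 * t - 1) := by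
    intro t
    have := (hδ.contDiff.differentiable (by norm_num) (2 * t - 1)).hasDerivAt.scomp t
      (((hasDerivAt_id t).const_mul (2 : ℝ)).sub_const 1)
    simpa [Function.comp_def] using this.deriv
  have hcont : Continuous κ := by
    refine Continuous.if_le c1.continuous c2.continuous continuous_id continuous_const ?_
    rintro t rfl
    norm_num [h]
  have e1 : ∀ t : ℝ, t < 1 / 2 → κ =ᶠ[nhds t] fun t => γ (2 * t) := fun t ht => by
    filter_upwards [Iio_mem_nhds ht] with x hx
    exact if_pos (le_of_lt hx)
  have e2 : ∀ t : ℝ, 1 / 2 < t → κ =ᶠ[nhds t] fun t => δ (2 * t - 1) := fun t ht => by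
    filter_upwards [Ioi_mem_nhds ht] with x hx
    exact if_neg (not_le_of_gt hx)
  have hval : ∀ t, t ≠ 1 / 2 → ContDiffAt ℝ 1 κ t ∧ (inner ℂ (κ t) (deriv κ t)).im = 0 ∧
      ‖deriv κ t‖ ≤ 2 * L := by
    intro t ht
    rcases lt_or_gt_of_ne ht with ht | ht
    · refine ⟨c1.contDiffAt.congr_of_eventuallyEq (e1 t ht), ?_, ?_⟩
      · rw [(e1 t ht).deriv_eq, (e1 t ht).eq_of_nhds, d1, inner_smul_right_eq_smul]
        simp [hγ.horizontal]
      · rw [(e1 t ht).deriv_eq, d1, norm_smul]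
        simpa using hγ.speed (2 * t)
    · refine ⟨c2.contDiffAt.congr_of_eventuallyEq (e2 t ht), ?_, ?_⟩
      · rw [(e2 t ht).deriv_eq, (e2 t ht).eq_of_nhds, d2, inner_smul_right_eq_smul]
        simp [hδ.horizontal]
      · rw [(e2 t ht).deriv_eq, d2, norm_smul]
        simpa using hδ.speed (2 * t - 1)
  refine (iInf₂_le κ ⟨⟨hcont.continuousOn, ?_, {1 / 2}, ?_⟩, ?_, ?_⟩).trans
    (horizontalLength_le (F := {1 / 2}) fun t _ ht => (hval t (by simpa using ht)).2.2)
  · intro t _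
    simp only [hκ, mem_sphere_zero_iff_norm]
    split_ifs
    exacts [hγ.norm_eq _, hδ.norm_eq _]
  · intro t _ ht
    have := hval t (by simpa using ht)
    exact ⟨this.1, by rw [theta_apply]; exact this.2.1⟩
  · simp [hκ, h0]
  · norm_num [hκ, h1]

/-- The orbit `t ↦ e^{iαt} A + e^{iβt} B` of a one-parameter group of unitary maps. -/
def orbitCurve {n : ℕ} (α β : ℝ) (A B : Amb n) (t : ℝ) : Amb n :=
  Complex.exp (t * α * Complex.I) • A + Complex.exp (t * β * Complex.I) • B

/-- For orthogonal `A`, `B` the phases cancel in every inner product: `⟨γ, γ'⟩ = i(α‖A‖² + β‖B‖²)`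
and `|γ'|² = α²‖A‖² + β²‖B‖²` do not depend on `t`. Horizontality is therefore a single linear
condition. -/
theorem isHorizontalLine_orbitCurve {n : ℕ} {α β L : ℝ} {A B : Amb n} (hAB : inner ℂ A B = 0)
    (h1 : ‖A‖ ^ 2 + ‖B‖ ^ 2 = 1) (h2 : α * ‖A‖ ^ 2 + β * ‖B‖ ^ 2 = 0) (hL : 0 ≤ L)
    (h3 : α ^ 2 * ‖A‖ ^ 2 + β ^ 2 * ‖B‖ ^ 2 ≤ L ^ 2) :
    IsHorizontalLine n (orbitCurve α β A B) L := by
  have hBA : inner ℂ B A = 0 := inner_eq_zero_symm.1 hAB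
  have hexp : ∀ α t : ℝ, HasDerivAt (fun t : ℝ => Complex.exp (t * α * Complex.I))
      (Complex.exp (t * α * Complex.I) * (α * Complex.I)) t := by
    intro α t
    have : HasDerivAt (fun t : ℝ => (t * α * Complex.I : ℂ)) (α * Complex.I) t := by
      simpa [mul_assoc] using (Complex.ofRealCLM.hasDerivAt (x := t)).mul_const (α * Complex.I)
    exact this.cexp
  have hder : ∀ t : ℝ, deriv (orbitCurve α β A B) t =
      (Complex.exp (t * α * Complex.I) * (α * Complex.I)) • A +
        (Complex.exp (t * β * Complex.I) * (β * Complex.I)) • B := fun t =>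
    (((hexp α t).smul_const A).add ((hexp β t).smul_const B)).deriv
  have hn : ∀ a t : ℝ, ‖Complex.exp (t * a * Complex.I)‖ = 1 := fun a t => by
    rw [← Complex.ofReal_mul, Complex.norm_exp_ofReal_mul_I]
  have hpy : ∀ a b : ℂ, ‖a • A + b • B‖ ^ 2 = ‖a‖ ^ 2 * ‖A‖ ^ 2 + ‖b‖ ^ 2 * ‖B‖ ^ 2 := by
    intro a b
    have : inner ℂ (a • A) (b • B) = 0 := by rw [inner_smul_left, inner_smul_right, hAB, mul_zero, mul_zero]
    have := norm_add_sq_eq_norm_sq_add_norm_sq_of_inner_eq_zero _ _ this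
    rw [pow_two, this, norm_smul, norm_smul]; ring
  have hc : ∀ a t : ℝ, (starRingEnd ℂ) (Complex.exp (t * a * Complex.I)) *
      Complex.exp (t * a * Complex.I) = 1 := fun a t => by
    rw [mul_comm, Complex.mul_conj, Complex.normSq_eq_norm_sq, hn]; simp
  refine ⟨?_, fun t => ?_, fun t => ?_, fun t => ?_⟩
  · unfold orbitCurve
    have hs : ∀ a : ℝ, ContDiff ℝ 1 fun t : ℝ => Complex.exp (t * a * Complex.I) := fun a =>
      Complex.contDiff_exp.comp ((Complex.ofRealCLM.contDiff.mul contDiff_const).mul contDiff_const)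
    exact ((hs α).smul contDiff_const).add ((hs β).smul contDiff_const)
  · have := hpy (Complex.exp (t * α * Complex.I)) (Complex.exp (t * β * Complex.I))
    rw [hn, hn, one_pow, one_mul, one_mul, h1] at this
    exact (pow_eq_one_iff_of_nonneg (norm_nonneg _) two_ne_zero).1 this
  · rw [hder, orbitCurve]
    simp only [inner_add_left, inner_add_right, inner_smul_left, inner_smul_right, hAB, hBA,
      mul_zero, add_zero, zero_add]
    have e : ∀ (a : ℝ) (X : Amb n), (starRingEnd ℂ) (Complex.exp (t * a * Complex.I)) *
        (Complex.exp (t * a * Complex.I) * (a * Complex.I) * inner ℂ X X) =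
        ((a * ‖X‖ ^ 2 : ℝ) : ℂ) * Complex.I := by
      intro a X
      rw [inner_self_eq_norm_sq_to_K]
      push_cast
      linear_combination (a * Complex.I * (‖X‖ : ℂ) ^ 2) * hc a t
    have e' : ∀ (a : ℝ) (X : Amb n), Complex.exp (t * a * Complex.I) * (a * Complex.I) *
        ((starRingEnd ℂ) (Complex.exp (t * a * Complex.I)) * inner ℂ X X) =
        ((a * ‖X‖ ^ 2 : ℝ) : ℂ) * Complex.I := by
      intro a X
      rw [← e]; ring
    simp only [e', ← add_mul, ← Complex.ofReal_add, h2]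
    simp
  · rw [hder]
    refine abs_le_of_sq_le_sq' ?_ hL |>.2
    rw [hpy]
    simpa [hn] using h3

theorem exists_orthonormalBasis_zero_eq {n : ℕ} {z : Amb n} (hz : ‖z‖ = 1) :
    ∃ b : OrthonormalBasis (Fin (n + 1)) ℂ (Amb n), b 0 = z := by
  have h : Orthonormal ℂ (({0} : Set (Fin (n + 1))).domRestrict fun _ => z) := by
    refine ⟨fun i => hz, fun i j hij => (hij (Subsingleton.elim i j)).elim⟩
  obtain ⟨b, hb⟩ := h.exists_orthonormalBasis_extension_of_card_eq (by simp)
  exact ⟨b, hb 0 rfl⟩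

theorem exists_unit_orthogonal {n : ℕ} (hn : 1 ≤ n) {z : Amb n} (hz : ‖z‖ = 1) :
    ∃ e : Amb n, ‖e‖ = 1 ∧ inner ℂ z e = 0 := by
  obtain ⟨b, rfl⟩ := exists_orthonormalBasis_zero_eq hz
  exact ⟨b ⟨1, by omega⟩, b.norm_eq_one _, b.inner_eq_zero (by simp [Fin.ext_iff])⟩

/-- Motion along the fibre is transverse to `ker θ₀`, so the curve makes a detour in a second
complex direction `e`. Its squared speed is `2π|φ| - φ²`: a phase `φ` costs length of order
`|φ|^(1/2)`. -/
theorem exists_fibre_line {n : ℕ} (hn : 1 ≤ n) {z : Amb n} (hz : ‖z‖ = 1) {φ L : ℝ}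
    (hφ : |φ| ≤ Real.pi) (hL : 0 ≤ L) (h : 2 * Real.pi * |φ| ≤ L ^ 2) :
    ∃ γ, IsHorizontalLine n γ L ∧ γ 0 = z ∧ γ 1 = Complex.exp (φ * Complex.I) • z := by
  obtain ⟨e, he, hze⟩ := exists_unit_orthogonal hn hz
  have hez : inner ℂ e z = 0 := inner_eq_zero_symm.1 hze
  have hpi := Real.pi_pos
  obtain ⟨σ, hσ, hσ'⟩ : ∃ σ : ℤ, σ * σ = 1 ∧ (σ : ℝ) * φ = |φ| := by
    rcases le_total 0 φ with h | h
    · exact ⟨1, by norm_num, by simp [abs_of_nonneg h]⟩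
    · exact ⟨-1, by norm_num, by simp [abs_of_nonpos h]⟩
  have hσ2 : (σ : ℝ) * σ = 1 := by exact_mod_cast hσ
  -- The weights will be `‖A‖² = 1 - b` and `‖B‖² = b`; horizontality `φ(1 - b) + (φ - 2πσ)b = 0`
  -- forces `2πb = |φ|`. The choice `k² = b(1 - b)` below makes `A = (1 - b)z + ke` and `B = bz -
  -- ke` orthogonal with sum `z`.
  set b : ℝ := |φ| / (2 * Real.pi) with hb
  have hb0 : 0 ≤ b := by positivity
  have hb1 : b ≤ 1 := by rw [hb, div_le_one (by positivity)]; linarith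
  have hbφ : 2 * Real.pi * b = |φ| := by rw [hb]; field_simp
  have hk := Real.mul_self_sqrt (mul_nonneg hb0 (sub_nonneg.2 hb1))
  set k := √(b * (1 - b))
  have hpy : ∀ x y : ℝ, ‖(x : ℂ) • z + (y : ℂ) • e‖ ^ 2 = x ^ 2 + y ^ 2 := by
    intro x y
    have := norm_add_sq_eq_norm_sq_add_norm_sq_of_inner_eq_zero (𝕜 := ℂ) ((x : ℂ) • z)
      ((y : ℂ) • e)
      (by rw [inner_smul_left, inner_smul_right, hze]; simp)
    rw [pow_two, this, norm_smul, norm_smul, hz, he]; simp [pow_two]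
  have hA := hpy (1 - b) k
  have hB := hpy b (-k)
  have hAB : inner ℂ (((1 - b : ℝ) : ℂ) • z + (k : ℂ) • e) ((b : ℂ) • z + ((-k : ℝ) : ℂ) • e)
      = 0 := by
    simp only [inner_add_left, inner_add_right, inner_smul_left, inner_smul_right, hze, hez,
      inner_self_eq_norm_sq_to_K, hz, he, Complex.conj_ofReal]
    have : (k : ℂ) * k = b * (1 - b) := by exact_mod_cast hk
    push_cast
    linear_combination -this
  -- The frequencies differ by `±2π`, so at time 1 both components carry the phase `e^{iφ}`.
  refine ⟨orbitCurve φ (φ - σ * (2 * Real.pi)) _ _,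
    isHorizontalLine_orbitCurve hAB ?_ ?_ hL ?_, ?_, ?_⟩
  · rw [hA, hB]; linear_combination 2 * hk
  · rw [hA, hB]
    linear_combination (φ + (φ - σ * (2 * Real.pi))) * hk - (σ : ℝ) * hbφ + (σ : ℝ) * hσ' -
      φ * hσ2
  · rw [hA, hB]
    refine le_trans ?_ h
    have e1 : φ ^ 2 * ((1 - b) ^ 2 + k ^ 2) + (φ - σ * (2 * Real.pi)) ^ 2 * (b ^ 2 + (-k) ^ 2) =
        2 * Real.pi * |φ| - φ ^ 2 := by
      have h3 : (φ - σ * (2 * Real.pi)) ^ 2 = φ ^ 2 - 4 * Real.pi * |φ| + 4 * Real.pi ^ 2 := by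
        linear_combination 4 * Real.pi ^ 2 * hσ2 - 4 * Real.pi * hσ'
      have h4 : |φ| ^ 2 = φ ^ 2 := sq_abs φ
      rw [h3]
      linear_combination (φ ^ 2 + (φ ^ 2 - 4 * Real.pi * |φ| + 4 * Real.pi ^ 2)) * hk
        - 2 * (|φ| - Real.pi) * hbφ - 2 * h4
    rw [e1]; nlinarith [sq_nonneg φ]
  · simp only [orbitCurve, Complex.ofReal_zero, zero_mul, Complex.exp_zero, one_smul]
    push_cast
    module
  · have : Complex.exp ((φ - σ * (2 * Real.pi) : ℝ) * Complex.I) = Complex.exp (φ * Complex.I) := by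
      rw [Complex.exp_eq_exp_iff_exists_int]
      exact ⟨-σ, by push_cast; ring⟩
    simp only [orbitCurve, Complex.ofReal_one, one_mul, this]
    push_cast
    module

/-- When `⟨x, y⟩` is real, the great circle `cos(αt) x + sin(αt) e` is horizontal. It is the orbit
with frequencies `±α` and components `(x ∓ ie)/2`, where `cos α = ρ`. -/
theorem exists_greatCircle_line {n : ℕ} (hn : 1 ≤ n) {x y : Amb n} (hx : ‖x‖ = 1) (hy : ‖y‖ = 1)
    {ρ L : ℝ} (hρ : 0 ≤ ρ) (hxy : inner ℂ x y = ρ) (hL : 0 ≤ L)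
    (h : Real.pi ^ 2 * (1 - ρ) ≤ 2 * L ^ 2) :
    ∃ γ, IsHorizontalLine n γ L ∧ γ 0 = x ∧ γ 1 = y := by
  have hρ1 : ρ ≤ 1 := by
    have := norm_inner_le_norm (𝕜 := ℂ) x y
    rw [hxy, hx, hy, Complex.norm_real, Real.norm_of_nonneg hρ] at this
    linarith
  have hsub : ∀ c : ℝ, ‖y - (c : ℂ) • x‖ ^ 2 = 1 - 2 * c * ρ + c ^ 2 := by
    intro c
    rw [@norm_sub_sq ℂ, inner_smul_right, ← inner_conj_symm, hxy, hy, norm_smul, hx]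
    simp
    ring
  obtain ⟨e, he, hxe, hye⟩ : ∃ e : Amb n, ‖e‖ = 1 ∧ inner ℂ x e = 0 ∧
      y = (ρ : ℂ) • x + ((√(1 - ρ ^ 2) : ℝ) : ℂ) • e := by
    rcases eq_or_lt_of_le hρ1 with h1 | h1
    · obtain ⟨e, he, hxe⟩ := exists_unit_orthogonal hn hx
      refine ⟨e, he, hxe, ?_⟩
      have := hsub 1
      rw [h1] at this
      norm_num [sub_eq_zero] at this
      simp [h1, this]
    · have hpos : 0 < 1 - ρ ^ 2 := by nlinarith
      have hne : √(1 - ρ ^ 2) ≠ 0 := (Real.sqrt_pos.2 hpos).ne'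
      refine ⟨((√(1 - ρ ^ 2) : ℝ) : ℂ)⁻¹ • (y - (ρ : ℂ) • x), ?_, ?_, ?_⟩
      · have h2 : ‖y - (ρ : ℂ) • x‖ = √(1 - ρ ^ 2) := by
          rw [← Real.sqrt_sq (norm_nonneg _), hsub]; ring_nf
        rw [norm_smul, h2, norm_inv, Complex.norm_real, Real.norm_of_nonneg (Real.sqrt_nonneg _),
          inv_mul_cancel₀ hne]
      · simp [hxy, inner_self_eq_norm_sq_to_K, hx]
      · rw [smul_inv_smul₀ (by exact_mod_cast hne)]; abel
  have hex : inner ℂ e x = 0 := inner_eq_zero_symm.1 hxe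
  set α := Real.arccos ρ with hα
  have hcos : Real.cos α = ρ := Real.cos_arccos (by linarith) hρ1
  have hsin : Real.sin α = √(1 - ρ ^ 2) := Real.sin_arccos ρ
  -- From `cos α ≤ 1 - 2α²/π²` one gets `2α² ≤ π²(1 - ρ)`.
  have hαL : α ^ 2 ≤ L ^ 2 := by
    have h3 := Real.cos_le_one_sub_mul_cos_sq (x := α)
      (abs_le.2 ⟨by linarith [Real.arccos_nonneg ρ, Real.pi_pos], Real.arccos_le_pi ρ⟩)
    rw [hcos] at h3
    have hpi := Real.pi_pos
    have h4 : Real.pi ^ 2 * (2 / Real.pi ^ 2 * α ^ 2) = 2 * α ^ 2 := by field_simp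
    nlinarith [mul_le_mul_of_nonneg_left h3 (sq_nonneg Real.pi)]
  have hpy : ∀ c : ℂ, ‖c‖ = 1 → ‖(1 / 2 : ℂ) • (x + c • e)‖ ^ 2 = 1 / 2 := by
    intro c hc
    have := norm_add_sq_eq_norm_sq_add_norm_sq_of_inner_eq_zero (𝕜 := ℂ) x (c • e)
      (by rw [inner_smul_right, hxe, mul_zero])
    rw [norm_smul c, hx, he, hc] at this
    rw [norm_smul, mul_pow, pow_two ‖x + c • e‖, this]; norm_num
  have hA := hpy (-Complex.I) (by simp)
  have hB := hpy Complex.I (by simp)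
  have hAB : inner ℂ ((1 / 2 : ℂ) • (x + (-Complex.I) • e)) ((1 / 2 : ℂ) • (x + Complex.I • e))
      = 0 := by
    have hI := Complex.I_mul_I
    rw [inner_smul_left, inner_smul_right, inner_add_left, inner_add_right, inner_add_right,
      inner_smul_left, inner_smul_left, inner_smul_right, inner_smul_right, hxe, hex,
      inner_self_eq_norm_sq_to_K, inner_self_eq_norm_sq_to_K, hx, he, map_neg, Complex.conj_I]
    simp [hI]
  refine ⟨orbitCurve α (-α) _ _, isHorizontalLine_orbitCurve hAB ?_ ?_ hL ?_, ?_, ?_⟩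
  · rw [hA, hB]; norm_num
  · rw [hA, hB]; ring
  · rw [hA, hB]; linarith
  · simp only [orbitCurve, Complex.ofReal_zero, zero_mul, Complex.exp_zero, one_smul]
    module
  · have h5 : ∀ t : ℝ, Complex.exp (t * Complex.I) = Real.cos t + Real.sin t * Complex.I := by
      intro t; rw [Complex.exp_mul_I]; simp
    simp only [orbitCurve, Complex.ofReal_one, one_mul, h5, Real.cos_neg, Real.sin_neg]
    rw [hcos, hsin]
    conv_rhs => rw [hye]
    set s := √(1 - ρ ^ 2)
    push_cast
    have hI := Complex.I_mul_I
    simp only [smul_add, smul_smul]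
    match_scalars
    · ring
    · linear_combination (-(s : ℂ)) * hI

/-- Removing the phase of `⟨ξ, η⟩` from `η` gives a point `ζ` with `⟨ξ, ζ⟩ ≥ 0`. A great circle
leads from `ξ` to `ζ` and a fibre curve from `ζ` to `η`. Each has speed at most `4r`, and `√2 · 8 ≤
12`. -/
theorem ccDist_le_of_inner {n : ℕ} (hn : 1 ≤ n) {ξ η : Sph n} {r : ℝ} (hr : 0 ≤ r)
    (h1 : 1 - ‖inner ℂ (ξ : Amb n) η‖ ≤ r ^ 2) (h2 : |(inner ℂ (ξ : Amb n) η).arg| ≤ r ^ 2) :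
    ccDist n ξ η ≤ ENNReal.ofReal (12 * r) := by
  have hξ : ‖(ξ : Amb n)‖ = 1 := norm_eq_of_mem_sphere ξ
  have hη : ‖(η : Amb n)‖ = 1 := norm_eq_of_mem_sphere η
  have hpi := Real.pi_pos
  have hpi4 : Real.pi < 4 := by linarith [Real.pi_lt_d2]
  set φ := (inner ℂ (ξ : Amb n) η).arg with hφ
  set ρ := ‖inner ℂ (ξ : Amb n) η‖ with hρ
  have hin : inner ℂ (ξ : Amb n) η = ρ * Complex.exp (φ * Complex.I) :=
    (Complex.norm_mul_exp_arg_mul_I _).symm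
  have hee : Complex.exp (-(φ * Complex.I)) * Complex.exp (φ * Complex.I) = 1 := by
    rw [← Complex.exp_add]; simp
  have hne : ‖Complex.exp (-(φ * Complex.I))‖ = 1 := by
    rw [← neg_mul, ← Complex.ofReal_neg, Complex.norm_exp_ofReal_mul_I]
  set ζ : Amb n := Complex.exp (-(φ * Complex.I)) • (η : Amb n) with hζ
  have hζn : ‖ζ‖ = 1 := by rw [hζ, norm_smul, hne, hη, one_mul]
  obtain ⟨γ, hγ, hγ0, hγ1⟩ := exists_greatCircle_line hn hξ hζn (norm_nonneg _)
    (show inner ℂ (ξ : Amb n) ζ = (ρ : ℂ) by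
      rw [hζ, inner_smul_right, hin]; linear_combination (ρ : ℂ) * hee)
    (L := 4 * r) (by positivity) (by
      have : Real.pi ^ 2 ≤ 32 := by nlinarith
      nlinarith [mul_le_mul_of_nonneg_left h1 (sq_nonneg Real.pi), sq_nonneg r])
  obtain ⟨δ, hδ, hδ0, hδ1⟩ := exists_fibre_line hn hζn (φ := φ) (L := 4 * r)
    (Complex.abs_arg_le_pi _) (by positivity) (by nlinarith [abs_nonneg φ])
  refine (ccDist_le_of_isHorizontalLine hγ hδ (hγ1.trans hδ0.symm) hγ0 ?_).trans
    (ENNReal.ofReal_le_ofReal ?_)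
  · rw [hδ1, hζ, smul_smul, mul_comm, hee, one_smul]
  · have : √2 ≤ 3 / 2 := by rw [Real.sqrt_le_left (by norm_num)]; norm_num
    nlinarith

/-- The horizontal length dominates the Euclidean length, hence the chord. This matters because a
quotient by `d = 0` is `0` in Lean, so a zero of `d` off the diagonal would hide oscillation from
the seminorm. -/
theorem ccDist_pos {n : ℕ} {ξ η : Sph n} (h : ξ ≠ η) : 0 < ccDist n ξ η := by
  have hd : 0 < ‖(η : Amb n) - ξ‖ := norm_pos_iff.2 (sub_ne_zero.2 fun e => h (Subtype.ext e.symm))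
  refine lt_of_lt_of_le (ENNReal.ofReal_pos.2 hd) (le_iInf₂ fun γ hγ => ?_)
  obtain ⟨⟨hc, -, F, hF⟩, h0, h1⟩ := hγ
  have hle : ∫⁻ t in Icc (0 : ℝ) 1, ‖deriv γ t‖ₑ ≤ horizontalLength n γ := by
    refine lintegral_mono fun t => ?_
    rw [← ofReal_norm, dtheta_self]
    refine ENNReal.ofReal_le_ofReal (Real.le_sqrt_of_sq_le ?_)
    nlinarith [sq_nonneg ‖deriv γ t‖]
  refine le_trans ?_ hle
  by_cases hfin : ∫⁻ t in Icc (0 : ℝ) 1, ‖deriv γ t‖ₑ = ∞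
  · rw [hfin]; exact le_top
  have hi : IntervalIntegrable (deriv γ) volume 0 1 := by
    rw [intervalIntegrable_iff_integrableOn_Icc_of_le zero_le_one]
    exact ⟨(stronglyMeasurable_deriv γ).aestronglyMeasurable, lt_top_iff_ne_top.2 hfin⟩
  have := integral_eq_of_hasDerivAt_off_countable_of_le γ (deriv γ) zero_le_one
    F.finite_toSet.countable hc
    (fun t ht => ((hF t ht.1 (by simpa using ht.2)).1.differentiableAt (by norm_num)).hasDerivAt) hi
  rw [h0, h1, intervalIntegral.integral_of_le zero_le_one] at this
  rw [← this, ofReal_norm, ← restrict_Ioc_eq_restrict_Icc]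
  exact enorm_integral_le_lintegral_enorm _

open scoped Pointwise

/-! ### The volume density -/

theorem real_inner_eq_re {n : ℕ} (x y : Amb n) : inner ℝ x y = (inner ℂ x y).re := by
  simp [PiLp.inner_apply]

/-- A crude bound, `2^n` for each permutation, suffices: it serves only to make `vol` finite. -/
theorem abs_volForm_le {n : ℕ} {z : Amb n} (hz : ‖z‖ = 1) {v : Fin (2 * n + 1) → Amb n}
    (hv : ∀ i, ‖v i‖ = 1) : |volForm n z v| ≤ (2 * n + 1).factorial := by
  have hθ : ∀ i, |theta n z ![v i]| ≤ 1 := fun i => by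
    rw [theta_apply]
    refine (Complex.abs_im_le_norm _).trans ((norm_inner_le_norm _ _).trans ?_)
    rw [hz, hv, one_mul]
  have hdθ : ∀ i j, |dtheta n z ![v i, v j]| ≤ 2 := fun i j => by
    rw [dtheta_apply, abs_mul, abs_two]
    have := (Complex.abs_im_le_norm _).trans (norm_inner_le_norm (𝕜 := ℂ) (v i) (v j))
    rw [hv, hv, one_mul] at this
    linarith
  have hsum : |∑ σ : Equiv.Perm (Fin (2 * n + 1)),
      ((Equiv.Perm.sign σ : ℤ) : ℝ) * theta n z ![v (σ 0)] *
        ∏ k : Fin n, dtheta n z ![v (σ ⟨2 * k + 1, by omega⟩), v (σ ⟨2 * k + 2, by omega⟩)]| ≤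
      ∑ _ : Equiv.Perm (Fin (2 * n + 1)), (2 : ℝ) ^ n := by
    refine (Finset.abs_sum_le_sum_abs _ _).trans (Finset.sum_le_sum fun σ _ => ?_)
    rw [abs_mul, abs_mul, Finset.abs_prod]
    have h1 : |((Equiv.Perm.sign σ : ℤ) : ℝ)| = 1 := by
      rcases Int.units_eq_one_or (Equiv.Perm.sign σ) with h | h <;> simp [h]
    have h2 : ∏ k : Fin n, |dtheta n z ![v (σ ⟨2 * k + 1, by omega⟩),
        v (σ ⟨2 * k + 2, by omega⟩)]| ≤ 2 ^ n := by
      refine (Finset.prod_le_prod (fun k _ => abs_nonneg _) fun k _ => hdθ _ _).trans_eq ?_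
      simp
    rw [h1, one_mul]
    calc _ ≤ 1 * (2 : ℝ) ^ n := mul_le_mul (hθ _) h2 (Finset.prod_nonneg fun _ _ => abs_nonneg _)
          zero_le_one
      _ = _ := one_mul _
  rw [volForm, abs_mul, abs_of_pos (by positivity)]
  refine (mul_le_mul_of_nonneg_left hsum (by positivity)).trans (le_of_eq ?_)
  rw [Finset.sum_const, Finset.card_univ, Fintype.card_perm, Fintype.card_fin, nsmul_eq_mul]
  field_simp

theorem volDensity_le {n : ℕ} (ξ : Sph n) : volDensity n ξ ≤ (2 * n + 1).factorial := by
  refine iSup₂_le fun v hv => ?_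
  refine (ENNReal.ofReal_le_ofReal
    (abs_volForm_le (norm_eq_of_mem_sphere ξ) hv.1.1)).trans_eq ?_
  exact ENNReal.ofReal_natCast _

/-- The labels `none` for `iξ` and `some (k, j)` for the `2n` horizontal vectors of a frame. -/
def frameEquiv (n : ℕ) : Option (Fin n × Fin 2) ≃ Fin (2 * n + 1) :=
  ((Equiv.optionCongr finProdFinEquiv).trans (finSuccEquiv (n * 2)).symm).trans
    (finCongr (by ring))

theorem frameEquiv_none (n : ℕ) : frameEquiv n none = 0 := by
  ext; simp [frameEquiv]

theorem frameEquiv_some_zero {n : ℕ} (k : Fin n) :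
    frameEquiv n (some (k, 0)) = ⟨2 * k + 1, by omega⟩ := by
  ext; simp [frameEquiv]

theorem frameEquiv_some_one {n : ℕ} (k : Fin n) :
    frameEquiv n (some (k, 1)) = ⟨2 * k + 2, by omega⟩ := by
  ext; simp [frameEquiv]; ring

/-- The real frame `iξ, e₁, ie₁, …, eₙ, ieₙ` given by a complex orthonormal basis
`ξ, e₁, …, eₙ`. -/
def frameVec {n : ℕ} (b : OrthonormalBasis (Fin (n + 1)) ℂ (Amb n)) :
    Option (Fin n × Fin 2) → Amb n
  | none => Complex.I • b 0
  | some (k, j) => Complex.I ^ (j : ℕ) • b k.succ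

theorem isTangentFrame_frameVec {n : ℕ} {ξ : Sph n}
    {b : OrthonormalBasis (Fin (n + 1)) ℂ (Amb n)} (hb : b 0 = ξ) :
    IsTangentFrame n ξ (frameVec b ∘ (frameEquiv n).symm) := by
  have hin := orthonormal_iff_ite.1 b.orthonormal
  constructor
  · refine Orthonormal.comp ⟨?_, ?_⟩ _ (frameEquiv n).symm.injective
    · rintro (_ | ⟨k, j⟩) <;> simp [frameVec, norm_smul]
    · rintro (_ | ⟨k, j⟩) (_ | ⟨k', j'⟩) h <;>
        simp only [frameVec, real_inner_eq_re, inner_smul_left, inner_smul_right, hin]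
      · exact (h rfl).elim
      · simp [(Fin.succ_ne_zero k').symm]
      · simp [Fin.succ_ne_zero k]
      · by_cases hk : k = k'
        · subst hk
          fin_cases j <;> fin_cases j' <;> simp at h ⊢
        · simp [hk]
  · intro i
    rw [real_inner_eq_re, ← hb, Function.comp_apply]
    rcases (frameEquiv n).symm i with _ | ⟨k, j⟩ <;>
      simp only [frameVec, inner_smul_right, hin]
    · simp
    · simp [(Fin.succ_ne_zero k).symm]

theorem theta_frameVec {n : ℕ} {z : Amb n} {b : OrthonormalBasis (Fin (n + 1)) ℂ (Amb n)}
    (hb : b 0 = z) (a : Option (Fin n × Fin 2)) :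
    theta n z ![frameVec b a] = if a = none then 1 else 0 := by
  have hin := orthonormal_iff_ite.1 b.orthonormal
  rw [theta_apply, ← hb]
  rcases a with _ | ⟨k, j⟩ <;> simp only [frameVec, inner_smul_right, hin]
  · simp
  · simp [(Fin.succ_ne_zero k).symm]

theorem dtheta_frameVec {n : ℕ} (z : Amb n) (b : OrthonormalBasis (Fin (n + 1)) ℂ (Amb n))
    (x y : Fin n × Fin 2) :
    dtheta n z ![frameVec b (some x), frameVec b (some y)] =
      if x.1 = y.1 then 2 * ((y.2 : ℝ) - (x.2 : ℝ)) else 0 := by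
  have hin := orthonormal_iff_ite.1 b.orthonormal
  rw [dtheta_apply]
  obtain ⟨k, i⟩ := x
  obtain ⟨k', j⟩ := y
  simp only [frameVec, inner_smul_left, inner_smul_right, hin]
  by_cases hk : k = k'
  · subst hk
    fin_cases i <;> fin_cases j <;> simp
  · simp [hk]

/-- The product vanishes unless `τ` maps each pair `{(k,0), (k,1)}` onto a pair. Then `τ` is a
permutation of the pairs composed with flips inside them; the former is even, and the sign of each
flip cancels against the sign of its `dθ₀` factor. -/
theorem sign_mul_prod_nonneg {n : ℕ} (τ : Equiv.Perm (Fin n × Fin 2)) :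
    0 ≤ ((Equiv.Perm.sign τ : ℤ) : ℝ) * ∏ k : Fin n,
      if (τ (k, 0)).1 = (τ (k, 1)).1 then
        2 * (((τ (k, 1)).2 : ℝ) - ((τ (k, 0)).2 : ℝ)) else 0 := by
  classical
  by_cases h : ∀ k, (τ (k, 0)).1 = (τ (k, 1)).1
  swap
  · push Not at h
    obtain ⟨k, hk⟩ := h
    rw [Finset.prod_eq_zero (Finset.mem_univ k) (if_neg hk), mul_zero]
  have hfst : ∀ k i, (τ (k, i)).1 = (τ (k, 0)).1 := by
    intro k i; fin_cases i
    exacts [rfl, (h k).symm]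
  have hεinj : ∀ k, Function.Injective fun i => (τ (k, i)).2 := by
    intro k i j hij
    have : τ (k, i) = τ (k, j) := Prod.ext ((hfst k i).trans (hfst k j).symm) hij
    exact (Prod.mk.inj (τ.injective this)).2
  let ε : Fin n → Equiv.Perm (Fin 2) := fun k =>
    Equiv.ofBijective _ (Finite.injective_iff_bijective.1 (hεinj k))
  have htsurj : Function.Surjective fun k => (τ (k, 0)).1 := by
    intro m
    refine ⟨(τ.symm (m, 0)).1, ?_⟩
    have := hfst (τ.symm (m, 0)).1 (τ.symm (m, 0)).2
    simp only [Prod.mk.eta, Equiv.apply_symm_apply] at this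
    exact this.symm
  let t : Equiv.Perm (Fin n) := Equiv.ofBijective _ (Finite.surjective_iff_bijective.1 htsurj)
  -- The permutation `t` acts once on each of the two columns, so its sign enters squared.
  have hτ : τ = Equiv.prodCongrLeft (fun _ : Fin 2 => t) * Equiv.prodCongrRight ε := by
    ext1 ⟨k, i⟩
    exact Prod.ext (hfst k i) rfl
  have hsign : (Equiv.Perm.sign τ : ℤ) = ∏ k, (Equiv.Perm.sign (ε k) : ℤ) := by
    have : Equiv.Perm.sign τ = ∏ k, Equiv.Perm.sign (ε k) := by
      conv_lhs => rw [hτ]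
      rw [Equiv.Perm.sign_mul, Equiv.Perm.sign_prodCongrLeft, Equiv.Perm.sign_prodCongrRight]
      simp
    rw [this]; push_cast; rfl
  have hε : ∀ e : Equiv.Perm (Fin 2),
      (((e 1 : Fin 2) : ℕ) : ℤ) - ((e 0 : Fin 2) : ℕ) = (Equiv.Perm.sign e : ℤ) := by decide
  have hprod : ∀ k, (if (τ (k, 0)).1 = (τ (k, 1)).1 then
      2 * (((τ (k, 1)).2 : ℝ) - ((τ (k, 0)).2 : ℝ)) else 0) =
      2 * ((Equiv.Perm.sign (ε k) : ℤ) : ℝ) := by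
    intro k
    rw [if_pos (h k), ← hε]
    push_cast; rfl
  rw [hsign, Finset.prod_congr rfl fun k _ => hprod k, Int.cast_prod, ← Finset.prod_mul_distrib]
  exact Finset.prod_nonneg fun k _ => by nlinarith [sq_nonneg ((Equiv.Perm.sign (ε k) : ℤ) : ℝ)]

/-- All terms of the permutation sum are nonnegative on this frame, and the identity alone
contributes `2^n`, which cancels the prefactor. -/
theorem one_le_volForm_frameVec {n : ℕ} {z : Amb n}
    {b : OrthonormalBasis (Fin (n + 1)) ℂ (Amb n)} (hb : b 0 = z) :
    1 ≤ volForm n z (frameVec b ∘ (frameEquiv n).symm) := by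
  classical
  set T : Equiv.Perm (Fin (2 * n + 1)) → ℝ := fun σ =>
    ((Equiv.Perm.sign σ : ℤ) : ℝ) * theta n z ![(frameVec b ∘ (frameEquiv n).symm) (σ 0)] *
      ∏ k : Fin n, dtheta n z ![(frameVec b ∘ (frameEquiv n).symm) (σ ⟨2 * k + 1, by omega⟩),
        (frameVec b ∘ (frameEquiv n).symm) (σ ⟨2 * k + 2, by omega⟩)] with hT
  have hTe : ∀ π : Equiv.Perm (Option (Fin n × Fin 2)), T ((frameEquiv n).permCongr π) =
      ((Equiv.Perm.sign π : ℤ) : ℝ) * theta n z ![frameVec b (π none)] *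
        ∏ k : Fin n, dtheta n z ![frameVec b (π (some (k, 0))),
          frameVec b (π (some (k, 1)))] := by
    intro π
    simp only [hT, Equiv.Perm.sign_permCongr, Equiv.permCongr_apply, Function.comp_apply,
      ← frameEquiv_some_zero, ← frameEquiv_some_one, ← frameEquiv_none, Equiv.symm_apply_apply]
  have hnonneg : ∀ σ, 0 ≤ T σ := by
    intro σ
    obtain ⟨π, rfl⟩ := (frameEquiv n).permCongr.surjective σ
    rw [hTe, theta_frameVec hb]
    split_ifs with h
    · obtain ⟨τ, rfl⟩ : ∃ τ, π = Equiv.optionCongr τ := by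
        refine ⟨Equiv.removeNone π, ?_⟩
        have := map_equiv_removeNone π
        rw [h, Equiv.swap_self] at this
        exact (this.trans (one_mul π)).symm
      rw [Equiv.optionCongr_sign, mul_one]
      simpa only [Equiv.optionCongr_apply, Option.map_some, dtheta_frameVec] using
        sign_mul_prod_nonneg τ
    · simp
  have hone : T 1 = 2 ^ n := by
    have : (1 : Equiv.Perm (Fin (2 * n + 1))) = (frameEquiv n).permCongr 1 := by
      ext; simp [Equiv.permCongr_apply]
    rw [this, hTe, theta_frameVec hb]
    simp [dtheta_frameVec]
  have hle := Finset.single_le_sum (f := T) (fun σ _ => hnonneg σ) (Finset.mem_univ 1)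
  rw [hone] at hle
  change 1 ≤ (1 / 2 ^ n : ℝ) * ∑ σ, T σ
  rw [one_div, ← div_eq_inv_mul, one_le_div (by positivity)]
  exact hle

theorem one_le_volDensity {n : ℕ} (ξ : Sph n) : 1 ≤ volDensity n ξ := by
  obtain ⟨b, hb⟩ := exists_orthonormalBasis_zero_eq (norm_eq_of_mem_sphere ξ)
  refine le_iSup₂_of_le _ (isTangentFrame_frameVec hb) ?_
  rw [← ENNReal.ofReal_one]
  exact ENNReal.ofReal_le_ofReal ((one_le_volForm_frameVec hb).trans (le_abs_self _))

/-! ### Volume of Korányi balls -/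

theorem toSphere_le_vol {n : ℕ} {S : Set (Sph n)} (hS : MeasurableSet S) :
    (volume : Measure (Amb n)).toSphere S ≤ vol n S := by
  rw [vol, withDensity_apply _ hS]
  calc _ = ∫⁻ _ in S, 1 ∂(volume : Measure (Amb n)).toSphere := by simp
    _ ≤ _ := lintegral_mono fun ξ => one_le_volDensity ξ

instance isFiniteMeasure_vol (n : ℕ) : IsFiniteMeasure (vol n) := by
  constructor
  rw [vol, withDensity_apply _ MeasurableSet.univ]
  refine (lintegral_mono fun ξ => volDensity_le ξ).trans_lt ?_
  rw [lintegral_const]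
  exact ENNReal.mul_lt_top (ENNReal.natCast_lt_top _) (measure_lt_top _ _)

/-- The complex coordinate `⟨ξ, ·⟩` as a real-linear map. -/
def coordMap {n : ℕ} (ξ : Amb n) : Amb n →ₗ[ℝ] ℂ :=
  ((innerSL ℂ ξ).restrictScalars ℝ).toLinearMap

theorem coordMap_apply {n : ℕ} (ξ z : Amb n) : coordMap ξ z = inner ℂ ξ z := rfl

theorem coordMap_self {n : ℕ} {ξ : Amb n} (hξ : ‖ξ‖ = 1) : coordMap ξ ξ = 1 := by
  simp [coordMap_apply, inner_self_eq_norm_sq_to_K, hξ]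

theorem coordMap_I_smul {n : ℕ} {ξ : Amb n} (hξ : ‖ξ‖ = 1) :
    coordMap ξ (Complex.I • ξ) = Complex.I := by
  rw [coordMap_apply, inner_smul_right, ← coordMap_apply, coordMap_self hξ, mul_one]

theorem norm_sq_eq_coordMap {n : ℕ} {ξ : Amb n} (hξ : ‖ξ‖ = 1) (w : Amb n) :
    ‖w‖ ^ 2 = ‖coordMap ξ w‖ ^ 2 + ‖w - coordMap ξ w • ξ‖ ^ 2 := by
  have h1 : inner ℂ ξ ξ = 1 := coordMap_self hξ
  have := norm_add_sq_eq_norm_sq_add_norm_sq_of_inner_eq_zero (𝕜 := ℂ) (coordMap ξ w • ξ)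
    (w - coordMap ξ w • ξ) (by
      rw [inner_smul_left, inner_sub_right, inner_smul_right, h1, coordMap_apply]; ring)
  rw [add_sub_cancel, norm_smul, hξ, mul_one] at this
  rw [pow_two, this]; ring

theorem coordMap_smul_self {n : ℕ} (ξ z : Amb n) : coordMap ξ z • ξ =
    (coordMap ξ z).re • ξ + (coordMap ξ z).im • (Complex.I • ξ) := by
  conv_lhs => rw [← Complex.re_add_im (coordMap ξ z)]
  rw [add_smul, mul_smul, Complex.coe_smul, Complex.coe_smul]

/-- The Heisenberg-type dilation at `ξ`: it fixes `ξ`, multiplies `iξ` by `r²` and the complex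
orthogonal complement of `ξ` by `r`. -/
def anisoDilation {n : ℕ} (ξ : Amb n) (r : ℝ) : Amb n →ₗ[ℝ] Amb n :=
  LinearMap.transvection (Complex.reLm.comp (coordMap ξ)) ((r⁻¹ - 1) • ξ) ∘ₗ
    LinearMap.transvection (Complex.imLm.comp (coordMap ξ)) ((r - 1) • (Complex.I • ξ)) ∘ₗ
      (r • LinearMap.id)

/-- The homothety contributes `r^(2n+2)`; the two transvections contribute `r` and `r⁻¹`, which
cancel. The exponent is the homogeneous dimension. -/
theorem det_anisoDilation {n : ℕ} {ξ : Amb n} (hξ : ‖ξ‖ = 1) {r : ℝ} (hr : 0 < r) :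
    LinearMap.det (anisoDilation ξ r) = r ^ (2 * n + 2) := by
  have hfin : Module.finrank ℝ (Amb n) = 2 * n + 2 := by
    rw [finrank_real_of_complex]
    simp; ring
  rw [anisoDilation, LinearMap.det_comp, LinearMap.det_comp, LinearMap.transvection.det,
    LinearMap.transvection.det, LinearMap.det_smul, LinearMap.det_id, hfin]
  simp only [LinearMap.comp_apply, map_smul, coordMap_self hξ, coordMap_I_smul hξ]
  simp
  field_simp

theorem anisoDilation_apply {n : ℕ} {ξ : Amb n} (hξ : ‖ξ‖ = 1) {r : ℝ} (hr : 0 < r) (z : Amb n) :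
    anisoDilation ξ r z = r • z + ((1 - r) * (coordMap ξ z).re) • ξ +
      ((r ^ 2 - r) * (coordMap ξ z).im) • (Complex.I • ξ) := by
  simp only [anisoDilation, LinearMap.comp_apply, LinearMap.transvection.apply,
    LinearMap.smul_apply, LinearMap.id_apply, map_smul, map_add, coordMap_I_smul hξ,
    Complex.reLm_coe, Complex.imLm_coe, Complex.I_re]
  generalize Complex.I • ξ = w
  match_scalars <;> (field_simp; try ring)

theorem coordMap_anisoDilation {n : ℕ} {ξ : Amb n} (hξ : ‖ξ‖ = 1) {r : ℝ} (hr : 0 < r)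
    (z : Amb n) : coordMap ξ (anisoDilation ξ r z) =
      ⟨(coordMap ξ z).re, r ^ 2 * (coordMap ξ z).im⟩ := by
  rw [anisoDilation_apply hξ hr, map_add, map_add, map_smul, map_smul, map_smul, coordMap_self hξ,
    coordMap_I_smul hξ]
  apply Complex.ext
  · simp only [Complex.add_re, Complex.smul_re, Complex.one_re, Complex.I_re, smul_eq_mul]
    ring
  · simp only [Complex.add_im, Complex.smul_im, Complex.one_im, Complex.I_im, smul_eq_mul]
    ring

theorem anisoDilation_sub {n : ℕ} {ξ : Amb n} (hξ : ‖ξ‖ = 1) {r : ℝ} (hr : 0 < r) (z : Amb n) :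
    anisoDilation ξ r z - coordMap ξ (anisoDilation ξ r z) • ξ = r • (z - coordMap ξ z • ξ) := by
  rw [coordMap_smul_self, coordMap_smul_self, coordMap_anisoDilation hξ hr,
    anisoDilation_apply hξ hr]
  generalize Complex.I • ξ = w
  module

/-- Here `x + iy` is the `ξ`-coordinate of a point near `ξ/2` and `q` the norm of its orthogonal
part; `A` and `N` are the norms of the `ξ`-coordinate and of the whole vector after dilation. The
last bound comes from `(N - A)(N + A) = r²q²`. -/
theorem dilation_estimates {x y q r A N : ℝ} (hr0 : 0 < r) (hr1 : r ≤ 1)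
    (h : (x - 1 / 2) ^ 2 + y ^ 2 + q ^ 2 < 1 / 64) (hA0 : 0 ≤ A) (hN0 : 0 ≤ N)
    (hA : A ^ 2 = x ^ 2 + (r ^ 2 * y) ^ 2) (hN : N ^ 2 = A ^ 2 + r ^ 2 * q ^ 2) :
    3 / 8 ≤ x ∧ 3 / 8 ≤ A ∧ |y| ≤ 1 / 8 ∧ N < 1 ∧ A ≤ N ∧ N - A ≤ r ^ 2 * N := by
  have hx : |x - 1 / 2| ≤ 1 / 8 :=
    abs_le_of_sq_le_sq (by linarith [sq_nonneg y, sq_nonneg q]) (by norm_num)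
  rw [abs_le] at hx
  have hx1 : 3 / 8 ≤ x := by linarith
  have hx2 : x ≤ 5 / 8 := by linarith
  have hy2 : y ^ 2 ≤ 1 / 64 := by linarith [sq_nonneg (x - 1 / 2), sq_nonneg q]
  have hq2 : q ^ 2 ≤ 1 / 64 := by linarith [sq_nonneg (x - 1 / 2), sq_nonneg y]
  have hy : |y| ≤ 1 / 8 := abs_le_of_sq_le_sq (by linarith) (by norm_num)
  have hr2 : r ^ 2 ≤ 1 := pow_le_one₀ hr0.le hr1
  have hr4 : (r ^ 2) ^ 2 ≤ 1 := pow_le_one₀ (sq_nonneg r) hr2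
  have hxA : x ≤ A := (abs_le_of_sq_le_sq' (by linarith [sq_nonneg (r ^ 2 * y)]) hA0).2
  have hrq : r ^ 2 * q ^ 2 ≤ r ^ 2 * (1 / 64) := mul_le_mul_of_nonneg_left hq2 (sq_nonneg r)
  have hrq0 : 0 ≤ r ^ 2 * q ^ 2 := by positivity
  have hry : (r ^ 2 * y) ^ 2 ≤ 1 / 64 := by
    rw [mul_pow]
    exact (mul_le_of_le_one_left (sq_nonneg y) hr4).trans hy2
  have hAN : A ≤ N := (abs_le_of_sq_le_sq' (by linarith) hN0).2
  refine ⟨hx1, hx1.trans hxA, hy, ?_, hAN, ?_⟩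
  · have : x ^ 2 ≤ 25 / 64 := by nlinarith
    refine (abs_lt_of_sq_lt_sq' (b := 1) ?_ zero_le_one).2
    linarith
  · have h3 : (N - A) * (N + A) ≤ r ^ 2 * (1 / 64) := by linarith
    have h4 : (N - A) * (3 / 4) ≤ (N - A) * (N + A) :=
      mul_le_mul_of_nonneg_left (by linarith) (by linarith)
    have h5 : r ^ 2 * (3 / 8) ≤ r ^ 2 * N := mul_le_mul_of_nonneg_left (by linarith) (sq_nonneg r)
    linarith [sq_nonneg r]

theorem abs_arg_le_of_im {a : ℂ} {ε : ℝ} (hε : 0 ≤ ε) (ha : 3 / 8 ≤ a.re)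
    (him : |a.im| ≤ ε * (1 / 8)) : |a.arg| ≤ ε := by
  have hA : 3 / 8 ≤ ‖a‖ := ha.trans ((le_abs_self _).trans (Complex.abs_re_le_norm a))
  have h5 : |a.arg| ≤ Real.pi / 2 := Complex.abs_arg_le_pi_div_two_iff.2 (by linarith)
  have h6 : 2 / Real.pi * |a.arg| ≤ |Real.sin a.arg| := Real.mul_abs_le_abs_sin h5
  rw [Complex.sin_arg, abs_div, abs_of_nonneg (norm_nonneg a)] at h6
  have h7 : |a.im| / ‖a‖ ≤ ε * (1 / 3) := by
    rw [div_le_iff₀ (by linarith)]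
    nlinarith [mul_le_mul_of_nonneg_left hA hε]
  have h8 : |a.arg| = Real.pi / 2 * (2 / Real.pi * |a.arg|) := by
    have := Real.pi_ne_zero
    field_simp
  have h9 : Real.pi / 2 * (2 / Real.pi * |a.arg|) ≤ 2 * (ε * (1 / 3)) :=
    mul_le_mul (by linarith [Real.pi_lt_d2]) (h6.trans h7) (by positivity) (by norm_num)
  linarith

/-- A ball around `ξ/2` stays away from the origin and inside the unit ball after dilation, so its
image can be projected radially to the sphere. The projection has `1 - |⟨ξ, ζ⟩| = (N - A)/N` and the
same argument as the image. -/
theorem anisoDilation_mem {n : ℕ} (ξ : Sph n) {r : ℝ} (hr0 : 0 < r) (hr1 : r ≤ 1)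
    {S : Set (Sph n)} (hsub : ∀ η : Sph n, 1 - ‖inner ℂ (ξ : Amb n) η‖ ≤ r ^ 2 →
      |(inner ℂ (ξ : Amb n) η).arg| ≤ r ^ 2 → η ∈ S) {z : Amb n}
    (hz : z ∈ Metric.ball ((1 / 2 : ℝ) • (ξ : Amb n)) (1 / 8)) :
    anisoDilation (ξ : Amb n) r z ∈ Ioo (0 : ℝ) 1 • ((↑) '' S : Set (Amb n)) := by
  have hξ : ‖(ξ : Amb n)‖ = 1 := norm_eq_of_mem_sphere ξ
  rw [mem_ball_iff_norm] at hz
  have hw := norm_sq_eq_coordMap hξ (z - (1 / 2 : ℝ) • (ξ : Amb n))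
  have hfw : coordMap (ξ : Amb n) (z - (1 / 2 : ℝ) • (ξ : Amb n)) =
      coordMap (ξ : Amb n) z - (1 / 2 : ℝ) := by
    rw [map_sub, map_smul, coordMap_self hξ, Complex.real_smul, mul_one]
  have hwz : z - (1 / 2 : ℝ) • (ξ : Amb n) - (coordMap (ξ : Amb n) z - (1 / 2 : ℝ)) • (ξ : Amb n) =
      z - coordMap (ξ : Amb n) z • (ξ : Amb n) := by
    rw [sub_smul, Complex.coe_smul]; abel
  have hlt : ‖z - (1 / 2 : ℝ) • (ξ : Amb n)‖ ^ 2 < (1 / 8) ^ 2 :=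
    pow_lt_pow_left₀ hz (norm_nonneg _) two_ne_zero
  rw [hw, hfw, hwz, Complex.sq_norm, Complex.normSq_apply, Complex.sub_re, Complex.sub_im,
    Complex.ofReal_re, Complex.ofReal_im, sub_zero] at hlt
  have hN := norm_sq_eq_coordMap hξ (anisoDilation (ξ : Amb n) r z)
  rw [anisoDilation_sub hξ hr0, norm_smul, mul_pow, Real.norm_of_nonneg hr0.le] at hN
  have hA : ‖coordMap (ξ : Amb n) (anisoDilation (ξ : Amb n) r z)‖ ^ 2 =
      (coordMap (ξ : Amb n) z).re ^ 2 + (r ^ 2 * (coordMap (ξ : Amb n) z).im) ^ 2 := by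
    rw [Complex.sq_norm, Complex.normSq_apply, coordMap_anisoDilation hξ hr0]; ring
  obtain ⟨hx, hA', hy, hN1, hAN, hNA⟩ := dilation_estimates hr0 hr1
    (by linarith) (norm_nonneg _) (norm_nonneg _) hA hN
  have hNpos : 0 < ‖anisoDilation (ξ : Amb n) r z‖ := by linarith
  let ζ : Sph n := ⟨‖anisoDilation (ξ : Amb n) r z‖⁻¹ • anisoDilation (ξ : Amb n) r z, by
    rw [mem_sphere_zero_iff_norm, norm_smul, norm_inv, norm_norm]
    exact inv_mul_cancel₀ hNpos.ne'⟩
  have hζ : inner ℂ (ξ : Amb n) (ζ : Amb n) = (‖anisoDilation (ξ : Amb n) r z‖⁻¹ : ℝ) *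
      coordMap (ξ : Amb n) (anisoDilation (ξ : Amb n) r z) := by
    rw [← coordMap_apply, ← Complex.real_smul, ← map_smul]
  refine Set.mem_smul.2 ⟨_, ⟨hNpos, hN1⟩, ζ, ⟨ζ, hsub ζ ?_ ?_, rfl⟩, smul_inv_smul₀ hNpos.ne' _⟩
  · rw [hζ, norm_mul, Complex.norm_real, Real.norm_of_nonneg (by positivity),
      ← div_eq_inv_mul, sub_le_iff_le_add, ← sub_le_iff_le_add', le_div_iff₀ hNpos]
    linarith
  · rw [hζ, Complex.arg_real_mul _ (by positivity)]
    refine abs_arg_le_of_im (sq_nonneg r) ?_ ?_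
    · rw [coordMap_anisoDilation hξ hr0]; exact hx
    · rw [coordMap_anisoDilation hξ hr0, abs_mul, abs_of_nonneg (sq_nonneg r)]
      exact mul_le_mul_of_nonneg_left hy (sq_nonneg r)

theorem vol_ge_of_koranyi {n : ℕ} (ξ : Sph n) {r : ℝ} (hr0 : 0 < r) (hr1 : r ≤ 1)
    {S : Set (Sph n)} (hS : MeasurableSet S)
    (hsub : ∀ η : Sph n, 1 - ‖inner ℂ (ξ : Amb n) η‖ ≤ r ^ 2 →
      |(inner ℂ (ξ : Amb n) η).arg| ≤ r ^ 2 → η ∈ S) :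
    ENNReal.ofReal (r ^ (2 * n + 2)) * volume (Metric.ball (0 : Amb n) (1 / 8)) ≤ vol n S := by
  have hξ : ‖(ξ : Amb n)‖ = 1 := norm_eq_of_mem_sphere ξ
  calc _ = volume (anisoDilation (ξ : Amb n) r '' Metric.ball ((1 / 2 : ℝ) • (ξ : Amb n)) (1 / 8)) := by
        rw [Measure.addHaar_image_linearMap, det_anisoDilation hξ hr0, abs_of_pos (by positivity),
          Measure.addHaar_ball_center volume ((1 / 2 : ℝ) • (ξ : Amb n))]
    _ ≤ volume (Ioo (0 : ℝ) 1 • ((↑) '' S : Set (Amb n))) := by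
        refine measure_mono ?_
        rintro _ ⟨z, hz, rfl⟩
        exact anisoDilation_mem ξ hr0 hr1 hsub hz
    _ ≤ (volume : Measure (Amb n)).toSphere S := by
        -- The surface measure is the real dimension times the volume of the cone; the dimension is
        -- discarded as a factor at least 1.
        rw [Measure.toSphere_apply' _ hS]
        refine le_mul_of_one_le_left zero_le ?_
        exact_mod_cast Module.finrank_pos
    _ ≤ _ := toSphere_le_vol hS

end CRSphere
end

noncomputable section

/-! ### A fractional Sobolev–Poincaré inequality on measure spaces -/

namespace FractionalSobolev

/-- The pointwise fractional gradient `(∫ |u ξ - u η|^p / d(ξ, η)^a dμ(ξ))^{1/p}`. -/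
def fracGrad {X : Type*} [MeasurableSpace X] (μ : Measure X) (d : X → X → ℝ) (a p : ℝ)
    (u : X → ℝ) (η : X) : ℝ≥0∞ :=
  (∫⁻ ξ, ENNReal.ofReal (|u ξ - u η| ^ p / d ξ η ^ a) ∂μ) ^ (1 / p)

variable {X : Type*} [MeasurableSpace X] {μ : Measure X} {d : X → X → ℝ} {Q s p q a : ℝ}

/-- On `B` one has `1 ≤ R^a / d^a`. Keeping `f` apart from `u` lets truncations be controlled by the
gradient of the original function. -/
theorem eLpNorm_sub_le_fracGrad (hp : 0 < p) (ha : 0 ≤ a) (hd0 : ∀ ξ η, 0 ≤ d ξ η)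
    (hdpos : ∀ ξ η, d ξ η = 0 → ξ = η) {u f : X → ℝ} {η : X}
    (hf : ∀ ξ, |f ξ - f η| ≤ |u ξ - u η|) {B : Set X} (hB : MeasurableSet B) {R : ℝ}
    (hR : 0 < R) (hBR : ∀ ξ ∈ B, d ξ η ≤ R) :
    eLpNorm (fun ξ => f ξ - f η) (ENNReal.ofReal p) (μ.restrict B) ≤
      ENNReal.ofReal (R ^ (a / p)) * fracGrad μ d a p u η := by
  rw [eLpNorm_eq_lintegral_rpow_enorm_toReal (by simpa using hp) ENNReal.ofReal_ne_top,
    ENNReal.toReal_ofReal hp.le, fracGrad, div_eq_mul_one_div a p, Real.rpow_mul hR.le,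
    ← ENNReal.ofReal_rpow_of_nonneg (by positivity) (by positivity),
    ← ENNReal.mul_rpow_of_nonneg _ _ (by positivity)]
  refine ENNReal.rpow_le_rpow ?_ (by positivity)
  rw [← lintegral_const_mul' _ _ ENNReal.ofReal_ne_top]
  refine (setLIntegral_mono' hB fun ξ hξ => ?_).trans (setLIntegral_le_lintegral _ _)
  rw [← ofReal_norm, ENNReal.ofReal_rpow_of_nonneg (norm_nonneg _) hp.le,
    ← ENNReal.ofReal_mul (by positivity), Real.norm_eq_abs]
  refine ENNReal.ofReal_le_ofReal ?_
  rcases (hd0 ξ η).eq_or_lt with h0 | h0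
  · rw [hdpos ξ η h0.symm]; simp [Real.zero_rpow hp.ne']
  · have h1 : |f ξ - f η| ^ p ≤ |u ξ - u η| ^ p :=
      Real.rpow_le_rpow (abs_nonneg _) (hf ξ) hp.le
    have h2 : d ξ η ^ a ≤ R ^ a := Real.rpow_le_rpow (hd0 ξ η) (hBR ξ hξ) ha
    have h3 : 0 < d ξ η ^ a := Real.rpow_pos_of_pos h0 _
    rw [mul_div_assoc', le_div_iff₀ h3, mul_comm (R ^ a)]
    exact mul_le_mul h1 h2 h3.le (by positivity)

/-- Averaging `u(η) - u(ξ)` over the whole space replaces the ball estimate at large scales. The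
bound holds at every `η`, not merely almost everywhere. -/
theorem exists_enorm_sub_average_le [IsFiniteMeasure μ] (hμ : μ ≠ 0) (hp : 1 < p) (ha : 0 ≤ a)
    (hd0 : ∀ ξ η, 0 ≤ d ξ η) (hdpos : ∀ ξ η, d ξ η = 0 → ξ = η) {M : ℝ}
    (hM : ∀ ξ η, d ξ η ≤ M) :
    ∃ D : ℝ, 0 ≤ D ∧ ∀ u : X → ℝ, MemLp u (ENNReal.ofReal p) μ → ∀ η,
      ‖u η - ⨍ ξ, u ξ ∂μ‖ₑ ≤ ENNReal.ofReal D * fracGrad μ d a p u η := by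
  have hp0 : 0 < p := by linarith
  have : NeZero μ := ⟨hμ⟩
  set c : ℝ≥0∞ := ‖(μ.real univ)⁻¹‖ₑ * (ENNReal.ofReal (max M 1 ^ (a / p)) *
    μ univ ^ (1 / (1 : ℝ≥0∞).toReal - 1 / (ENNReal.ofReal p).toReal)) with hc
  have hexp : 0 ≤ 1 / (1 : ℝ≥0∞).toReal - 1 / (ENNReal.ofReal p).toReal := by
    rw [ENNReal.toReal_ofReal hp0.le, ENNReal.toReal_one, sub_nonneg, div_le_div_iff₀ hp0 one_pos]
    linarith
  have hct : c ≠ ∞ := ENNReal.mul_ne_top enorm_ne_top (ENNReal.mul_ne_top ENNReal.ofReal_ne_top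
    (ENNReal.rpow_ne_top_of_nonneg hexp (measure_ne_top _ _)))
  refine ⟨c.toReal, ENNReal.toReal_nonneg, fun u hu η => ?_⟩
  rw [ENNReal.ofReal_toReal hct]
  have h1p : (1 : ℝ≥0∞) ≤ ENNReal.ofReal p := by simpa using hp.le
  have hui : Integrable u μ := hu.integrable h1p
  have hm : μ.real univ ≠ 0 := by simpa [Measure.real, ENNReal.toReal_eq_zero_iff] using hμ
  have e : u η - ⨍ ξ, u ξ ∂μ = -((μ.real univ)⁻¹ • ∫ ξ, (u ξ - u η) ∂μ) := by
    rw [average_eq, integral_sub hui (integrable_const _), integral_const]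
    simp only [smul_eq_mul]
    field_simp
    ring
  rw [e, enorm_neg, enorm_smul]
  calc _ ≤ ‖(μ.real univ)⁻¹‖ₑ * eLpNorm (fun ξ => u ξ - u η) 1 μ := by
        rw [eLpNorm_one_eq_lintegral_enorm]
        gcongr
        exact enorm_integral_le_lintegral_enorm _
    _ ≤ ‖(μ.real univ)⁻¹‖ₑ * (eLpNorm (fun ξ => u ξ - u η) (ENNReal.ofReal p) μ *
          μ univ ^ (1 / (1 : ℝ≥0∞).toReal - 1 / (ENNReal.ofReal p).toReal)) := by
        gcongr
        exact eLpNorm_le_eLpNorm_mul_rpow_measure_univ h1p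
          (hu.aestronglyMeasurable.sub aestronglyMeasurable_const)
    _ ≤ ‖(μ.real univ)⁻¹‖ₑ * (ENNReal.ofReal (max M 1 ^ (a / p)) * fracGrad μ d a p u η *
          μ univ ^ (1 / (1 : ℝ≥0∞).toReal - 1 / (ENNReal.ofReal p).toReal)) := by
        gcongr
        simpa using eLpNorm_sub_le_fracGrad (μ := μ) hp0 ha hd0 hdpos (u := u) (f := u) (η := η)
          (fun ξ => le_rfl) MeasurableSet.univ (R := max M 1) (by positivity)
          fun ξ _ => (hM ξ η).trans (le_max_left _ _)
    _ = _ := by rw [hc]; ring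

/-- Take the `L^p(B)` norm of the constant `f(η) = -(f - f(η)) + f` and divide by `μ(B)^(1/p)`. The
gradient part scales as `r^((Q+sp)/p - Q/p) = r^s`; Hölder on `B` turns the rest into `μ(B)^(-1/q)
‖f‖_q`. Only negative powers of `μ(B)` remain, so a lower volume bound suffices. -/
theorem enorm_le_of_ball (hQ : 0 < Q) (hs : 0 < s) (hp : 1 ≤ p) (hpq : p ≤ q)
    [IsFiniteMeasure μ]
    (hd0 : ∀ ξ η, 0 ≤ d ξ η) (hdpos : ∀ ξ η, d ξ η = 0 → ξ = η) {u f : X → ℝ}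
    (hfm : AEStronglyMeasurable f μ) {η : X} (hf : ∀ ξ, |f ξ - f η| ≤ |u ξ - u η|)
    {B : Set X} (hB : MeasurableSet B) {c C r : ℝ} (hc : 0 < c) (hC : 0 < C) (hr : 0 < r)
    (hBr : ∀ ξ ∈ B, d ξ η ≤ C * r) (hμB : ENNReal.ofReal (c * r ^ Q) ≤ μ B) :
    ‖f η‖ₑ ≤ ENNReal.ofReal (c ^ (-(1 / p)) * C ^ ((Q + s * p) / p) * r ^ s) *
        fracGrad μ d (Q + s * p) p u η +
      ENNReal.ofReal (c ^ (-(1 / q)) * r ^ (-(Q / q))) * eLpNorm f (ENNReal.ofReal q) μ := by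
  have hp0 : 0 < p := by linarith
  have hq0 : 0 < q := by linarith
  have hcr : 0 < c * r ^ Q := by positivity
  have hm0 : μ B ≠ 0 := (lt_of_lt_of_le (ENNReal.ofReal_pos.2 hcr) hμB).ne'
  have hmt : μ B ≠ ∞ := measure_ne_top _ _
  set m := μ B
  have hrestr : μ.restrict B ≠ 0 := by simpa using hm0
  have hmneg : ∀ t : ℝ, 0 < t → m ^ (-(1 / t)) ≤ ENNReal.ofReal ((c * r ^ Q) ^ (-(1 / t))) := by
    intro t ht
    rw [← ENNReal.ofReal_rpow_of_pos hcr, ENNReal.rpow_neg, ENNReal.rpow_neg]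
    exact ENNReal.inv_le_inv.2 (ENNReal.rpow_le_rpow hμB (by positivity))
  have h1 : ‖f η‖ₑ * m ^ (1 / p) ≤
      ENNReal.ofReal ((C * r) ^ ((Q + s * p) / p)) * fracGrad μ d (Q + s * p) p u η +
        eLpNorm f (ENNReal.ofReal q) μ * m ^ (1 / p - 1 / q) := by
    have hconst : eLpNorm (fun _ : X => f η) (ENNReal.ofReal p) (μ.restrict B) =
        ‖f η‖ₑ * m ^ (1 / p) := by
      rw [eLpNorm_const _ (by simpa using hp0) hrestr, ENNReal.toReal_ofReal hp0.le,
        Measure.restrict_apply_univ]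
    have hsplit : (fun _ : X => f η) = (fun ξ => -(f ξ - f η)) + f := by
      ext ξ; simp
    rw [← hconst, hsplit]
    refine (eLpNorm_add_le ?_ hfm.restrict (by simpa using hp)).trans (add_le_add ?_ ?_)
    · exact (hfm.restrict.sub aestronglyMeasurable_const).neg
    · rw [show (fun ξ => -(f ξ - f η)) = -(fun ξ => f ξ - f η) from rfl, eLpNorm_neg]
      exact eLpNorm_sub_le_fracGrad hp0 (by positivity) hd0 hdpos hf hB (by positivity) hBr
    · refine (eLpNorm_le_eLpNorm_mul_rpow_measure_univ (ENNReal.ofReal_le_ofReal hpq)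
        hfm.restrict).trans ?_
      rw [ENNReal.toReal_ofReal hp0.le, ENNReal.toReal_ofReal hq0.le, Measure.restrict_apply_univ]
      gcongr
      exact Measure.restrict_le_self
  calc ‖f η‖ₑ = ‖f η‖ₑ * m ^ (1 / p) * m ^ (-(1 / p)) := by
        rw [mul_assoc, ← ENNReal.rpow_add _ _ hm0 hmt]; simp
    _ ≤ (ENNReal.ofReal ((C * r) ^ ((Q + s * p) / p)) * fracGrad μ d (Q + s * p) p u η +
        eLpNorm f (ENNReal.ofReal q) μ * m ^ (1 / p - 1 / q)) * m ^ (-(1 / p)) := by gcongr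
    _ = ENNReal.ofReal ((C * r) ^ ((Q + s * p) / p)) * m ^ (-(1 / p)) *
          fracGrad μ d (Q + s * p) p u η + m ^ (-(1 / q)) * eLpNorm f (ENNReal.ofReal q) μ := by
        rw [add_mul, mul_assoc (eLpNorm f _ μ), ← ENNReal.rpow_add _ _ hm0 hmt]
        ring_nf
    _ ≤ ENNReal.ofReal ((C * r) ^ ((Q + s * p) / p)) * ENNReal.ofReal ((c * r ^ Q) ^ (-(1 / p))) *
          fracGrad μ d (Q + s * p) p u η + ENNReal.ofReal ((c * r ^ Q) ^ (-(1 / q))) *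
          eLpNorm f (ENNReal.ofReal q) μ := by
        gcongr
        exacts [hmneg p hp0, hmneg q hq0]
    _ = _ := by
        rw [← ENNReal.ofReal_mul (by positivity), Real.mul_rpow hC.le hr.le,
          Real.mul_rpow hc.le (by positivity), Real.mul_rpow hc.le (by positivity),
          ← Real.rpow_mul hr.le, ← Real.rpow_mul hr.le]
        congr 3
        · have : r ^ s = r ^ ((Q + s * p) / p) * r ^ (Q * -(1 / p)) := by
            rw [← Real.rpow_add hr]; congr 1; field_simp; ring
          rw [this]; ring
        · congr 2; ring

theorem le_of_forall_radius (hp : 0 < p) (hpq : p < q) (hQ : 0 < Q)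
    (hq : 1 / q = 1 / p - s / Q) {D K₁ K₂ : ℝ} (hD : 0 ≤ D) (hK₁ : 0 < K₁) (hK₂ : 0 ≤ K₂)
    {b U Y : ℝ≥0∞} (hY0 : Y ≠ 0) (hYt : Y ≠ ∞) (hb : b ≤ ENNReal.ofReal D * U)
    (h : ∀ r : ℝ, 0 < r → r ≤ 1 →
      b ≤ ENNReal.ofReal (K₁ * r ^ s) * U + ENNReal.ofReal (K₂ * r ^ (-(Q / q))) * Y) :
    b ≤ ENNReal.ofReal (D + K₁ + K₂) * (U ^ (p / q) * Y ^ (1 - p / q)) := by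
  have hq0 : 0 < q := hp.trans hpq
  have hpq1 : p / q < 1 := (div_lt_one hq0).2 hpq
  have hsp : s * p / Q = 1 - p / q := by
    have : p / q = p * (1 / q) := by ring
    rw [this, hq]; field_simp; ring
  rcases eq_or_ne U ∞ with rfl | hUt
  · rw [ENNReal.top_rpow_of_pos (by positivity), ENNReal.top_mul, ENNReal.mul_top]
    · exact le_top
    · exact (ENNReal.ofReal_pos.2 (by positivity)).ne'
    · exact (ENNReal.rpow_pos (pos_iff_ne_zero.2 hY0) hYt).ne'
  rcases eq_or_ne U 0 with rfl | hU0
  · rw [mul_zero] at hb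
    exact hb.trans zero_le
  -- If `U < Y` the balancing radius would exceed 1, and the global bound `b ≤ D U` takes over.
  rcases lt_or_ge U Y with hUY | hUY
  · calc b ≤ ENNReal.ofReal D * U := hb
      _ = ENNReal.ofReal D * (U ^ (p / q) * U ^ (1 - p / q)) := by
          rw [← ENNReal.rpow_add _ _ hU0 hUt]; simp
      _ ≤ _ := by
          gcongr
          · linarith
  lift U to NNReal using hUt
  lift Y to NNReal using hYt
  have hu : 0 < (U : ℝ) := by exact_mod_cast pos_iff_ne_zero.2 hU0
  have hy : 0 < (Y : ℝ) := by exact_mod_cast pos_iff_ne_zero.2 hY0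
  have hyu : (Y : ℝ) ≤ U := by exact_mod_cast hUY
  -- This radius makes `r^s U` and `r^(-Q/q) Y` equal.
  set r : ℝ := ((Y : ℝ) / U) ^ (p / Q) with hr
  have hr0 : 0 < r := by positivity
  have hr1 : r ≤ 1 := Real.rpow_le_one (by positivity) ((div_le_one hu).2 hyu) (by positivity)
  have e1 : r ^ s * U = (U : ℝ) ^ (p / q) * (Y : ℝ) ^ (1 - p / q) := by
    rw [hr, ← Real.rpow_mul (by positivity), show p / Q * s = 1 - p / q by rw [← hsp]; ring,
      Real.div_rpow hy.le hu.le, div_mul_eq_mul_div, div_eq_iff (by positivity)]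
    rw [mul_right_comm, ← Real.rpow_add hu]; simp [mul_comm]
  have e2 : r ^ (-(Q / q)) * Y = (U : ℝ) ^ (p / q) * (Y : ℝ) ^ (1 - p / q) := by
    rw [hr, ← Real.rpow_mul (by positivity), show p / Q * -(Q / q) = -(p / q) by field_simp,
      Real.div_rpow hy.le hu.le, Real.rpow_neg hu.le, div_inv_eq_mul, sub_eq_add_neg,
      Real.rpow_add hy, Real.rpow_one]
    ring
  have hU' : ((U : NNReal) : ℝ≥0∞) = ENNReal.ofReal U := ENNReal.ofReal_coe_nnreal.symm
  have hY' : ((Y : NNReal) : ℝ≥0∞) = ENNReal.ofReal Y := ENNReal.ofReal_coe_nnreal.symm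
  refine (h r hr0 hr1).trans ?_
  rw [hU', hY', ENNReal.ofReal_rpow_of_pos hu, ENNReal.ofReal_rpow_of_pos hy,
    ← ENNReal.ofReal_mul (by positivity), ← ENNReal.ofReal_mul (by positivity),
    ← ENNReal.ofReal_mul (by positivity), ← ENNReal.ofReal_mul (by positivity),
    ← ENNReal.ofReal_add (by positivity) (by positivity)]
  refine ENNReal.ofReal_le_ofReal ?_
  rw [mul_assoc, mul_assoc, e1, e2]
  have : 0 ≤ D * ((U : ℝ) ^ (p / q) * (Y : ℝ) ^ (1 - p / q)) := by positivity
  linarith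

/-- Integrating the `q`-th power gives `Y^q ≤ E^q Y^(q-p) ∫ U^p`; cancelling `Y^(q-p)` is legitimate
because `Y` is finite. -/
theorem eLpNorm_le_of_enorm_le (hp : 0 < p) (hpq : p < q) {f : X → ℝ}
    {U : X → ℝ≥0∞} {E : ℝ} (hE : 0 ≤ E) (hYt : eLpNorm f (ENNReal.ofReal q) μ ≠ ∞)
    (h : eLpNorm f (ENNReal.ofReal q) μ ≠ 0 → ∀ η, ‖f η‖ₑ ≤
      ENNReal.ofReal E * (U η ^ (p / q) * eLpNorm f (ENNReal.ofReal q) μ ^ (1 - p / q))) :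
    eLpNorm f (ENNReal.ofReal q) μ ≤ ENNReal.ofReal (E ^ (q / p)) * (∫⁻ η, U η ^ p ∂μ) ^ (1 / p) := by
  have hq0 : 0 < q := hp.trans hpq
  set Y := eLpNorm f (ENNReal.ofReal q) μ with hY
  rcases eq_or_ne Y 0 with h0 | h0
  · rw [h0]; exact zero_le
  have hpq1 : 0 ≤ 1 - p / q := by
    rw [sub_nonneg, div_le_one hq0]; exact hpq.le
  have hYq : Y ^ q = ∫⁻ η, ‖f η‖ₑ ^ q ∂μ := by
    rw [hY, eLpNorm_eq_lintegral_rpow_enorm_toReal (by simpa using hq0) ENNReal.ofReal_ne_top,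
      ENNReal.toReal_ofReal hq0.le, ← ENNReal.rpow_mul, one_div_mul_cancel hq0.ne',
      ENNReal.rpow_one]
  have hc : ENNReal.ofReal E ^ q * Y ^ (q - p) ≠ ∞ :=
    ENNReal.mul_ne_top (ENNReal.rpow_ne_top_of_nonneg hq0.le ENNReal.ofReal_ne_top)
      (ENNReal.rpow_ne_top_of_nonneg (by linarith) hYt)
  have h1 : Y ^ q ≤ ENNReal.ofReal E ^ q * Y ^ (q - p) * ∫⁻ η, U η ^ p ∂μ := by
    -- With a finite constant no measurability of `U` is needed.
    rw [hYq, ← lintegral_const_mul' _ _ hc]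
    refine lintegral_mono fun η => ?_
    refine (ENNReal.rpow_le_rpow (h h0 η) hq0.le).trans_eq ?_
    rw [ENNReal.mul_rpow_of_nonneg _ _ hq0.le, ENNReal.mul_rpow_of_nonneg _ _ hq0.le,
      ← ENNReal.rpow_mul, ← ENNReal.rpow_mul, div_mul_cancel₀ _ hq0.ne',
      show (1 - p / q) * q = q - p by field_simp]
    ring
  have h2 : Y ^ p ≤ ENNReal.ofReal E ^ q * ∫⁻ η, U η ^ p ∂μ := by
    have h3 : Y ^ q = Y ^ (q - p) * Y ^ p := by
      rw [← ENNReal.rpow_add _ _ h0 hYt]; simp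
    rw [h3, mul_comm (ENNReal.ofReal E ^ q), mul_assoc] at h1
    exact (ENNReal.mul_le_mul_iff_right (ENNReal.rpow_pos (pos_iff_ne_zero.2 h0) hYt).ne'
      (ENNReal.rpow_ne_top_of_nonneg (by linarith) hYt)).1 h1
  have h4 := ENNReal.rpow_le_rpow h2 (show 0 ≤ 1 / p by positivity)
  rwa [← ENNReal.rpow_mul, mul_one_div_cancel hp.ne', ENNReal.rpow_one,
    ENNReal.mul_rpow_of_nonneg _ _ (by positivity), ← ENNReal.rpow_mul, mul_one_div,
    ENNReal.ofReal_rpow_of_nonneg hE (by positivity)] at h4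

theorem exists_eLpNorm_sub_average_le [IsFiniteMeasure μ] (hμ : μ ≠ 0) (hQ : 0 < Q) (hs : 0 < s)
    (hp : 1 < p) (hpq : p < q) (hq : 1 / q = 1 / p - s / Q)
    (hd0 : ∀ ξ η, 0 ≤ d ξ η) (hdpos : ∀ ξ η, d ξ η = 0 → ξ = η) {M : ℝ} (hM : ∀ ξ η, d ξ η ≤ M)
    (hdm : ∀ η, Measurable fun ξ => d ξ η) {c C : ℝ} (hc : 0 < c) (hC : 0 < C)
    (hball : ∀ η, ∀ r : ℝ, 0 < r → r ≤ 1 → ENNReal.ofReal (c * r ^ Q) ≤ μ {ξ | d ξ η ≤ C * r}) :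
    ∃ A : ℝ, 0 ≤ A ∧ ∀ u : X → ℝ, MemLp u (ENNReal.ofReal p) μ →
      eLpNorm (fun η => u η - ⨍ ξ, u ξ ∂μ) (ENNReal.ofReal q) μ ≤ ENNReal.ofReal A *
        (∫⁻ η, ∫⁻ ξ, ENNReal.ofReal (|u ξ - u η| ^ p / d ξ η ^ (Q + s * p)) ∂μ ∂μ) ^ (1 / p) := by
  have hp0 : 0 < p := by linarith
  obtain ⟨D, hD, hDu⟩ := exists_enorm_sub_average_le (a := Q + s * p) hμ hp (by positivity) hd0
    hdpos hM
  set K₁ := c ^ (-(1 / p)) * C ^ ((Q + s * p) / p) with hK₁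
  set K₂ := c ^ (-(1 / q)) with hK₂
  have hK₁0 : 0 < K₁ := by positivity
  have hK₂0 : 0 < K₂ := by positivity
  refine ⟨(D + K₁ + K₂) ^ (q / p), by positivity, fun u hu => ?_⟩
  set w : X → ℝ := fun η => u η - ⨍ ξ, u ξ ∂μ with hw
  have hwm : AEStronglyMeasurable w μ := hu.aestronglyMeasurable.sub aestronglyMeasurable_const
  have hU : ∀ η, fracGrad μ d (Q + s * p) p u η ^ p =
      ∫⁻ ξ, ENNReal.ofReal (|u ξ - u η| ^ p / d ξ η ^ (Q + s * p)) ∂μ := fun η => by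
    rw [fracGrad, ← ENNReal.rpow_mul, one_div_mul_cancel hp0.ne', ENNReal.rpow_one]
  simp_rw [← hU]
  -- Truncations are bounded, hence in `L^q`, and do not increase differences; Fatou's lemma then
  -- removes the truncation.
  let f : ℕ → X → ℝ := fun k η => max (min (w η) k) (-k)
  have hfm : ∀ k, AEStronglyMeasurable (f k) μ := fun k =>
    (hwm.inf aestronglyMeasurable_const).sup aestronglyMeasurable_const
  have hfdiff : ∀ k ξ η, |f k ξ - f k η| ≤ |u ξ - u η| := fun k ξ η => by
    refine (abs_max_sub_max_le_abs _ _ _).trans ((abs_inf_sub_inf_le_abs _ _ _).trans_eq ?_)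
    simp [hw]
  have hk0 : ∀ k : ℕ, (0 : ℝ) ≤ k := fun k => k.cast_nonneg
  have hfw : ∀ k η, ‖f k η‖ ≤ ‖w η‖ := fun k η => by
    rw [Real.norm_eq_abs, Real.norm_eq_abs, abs_le]
    exact ⟨le_max_of_le_left (le_min (neg_abs_le _)
        ((neg_nonpos.2 (abs_nonneg _)).trans (hk0 k))),
      max_le ((min_le_left _ _).trans (le_abs_self _))
        ((neg_nonpos.2 (hk0 k)).trans (abs_nonneg _))⟩
  have hfk : ∀ k η, ‖f k η‖ ≤ k := fun k η => by
    rw [Real.norm_eq_abs, abs_le]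
    exact ⟨le_max_right _ _, max_le (min_le_right _ _) (by linarith [hk0 k])⟩
  have hlim : ∀ η, Filter.Tendsto (fun k => f k η) Filter.atTop (nhds (w η)) := fun η => by
    refine tendsto_const_nhds.congr' ?_
    obtain ⟨N, hN⟩ := exists_nat_ge |w η|
    filter_upwards [Filter.eventually_ge_atTop N] with k hk
    have hk' : |w η| ≤ k := hN.trans (by exact_mod_cast hk)
    rw [abs_le] at hk'
    simp only [f]
    rw [min_eq_left hk'.2, max_eq_left hk'.1]
  have hbound : ∀ k, eLpNorm (f k) (ENNReal.ofReal q) μ ≤ ENNReal.ofReal ((D + K₁ + K₂) ^ (q / p)) *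
      (∫⁻ η, fracGrad μ d (Q + s * p) p u η ^ p ∂μ) ^ (1 / p) := by
    intro k
    have hmem : MemLp (f k) (ENNReal.ofReal q) μ :=
      MemLp.of_bound (hfm k) k (Filter.Eventually.of_forall (hfk k))
    refine eLpNorm_le_of_enorm_le hp0 hpq (by positivity) hmem.2.ne fun h0 η => ?_
    refine le_of_forall_radius hp0 hpq hQ hq hD hK₁0 hK₂0.le h0 hmem.2.ne ?_ fun r hr0 hr1 => ?_
    · refine le_trans ?_ (hDu u hu η)
      rw [← ofReal_norm, ← ofReal_norm]
      exact ENNReal.ofReal_le_ofReal (hfw k η)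
    · exact enorm_le_of_ball hQ hs hp.le hpq.le hd0 hdpos (hfm k) (fun ξ => hfdiff k ξ η)
        (measurableSet_le (hdm η) measurable_const) hc hC hr0 (fun ξ hξ => hξ) (hball η r hr0 hr1)
  refine (Lp.eLpNorm_lim_le_liminf_eLpNorm hfm w (Filter.Eventually.of_forall hlim)).trans ?_
  exact Filter.liminf_le_of_le (by isBoundedDefault) fun b hb => by
    obtain ⟨k, hk⟩ := hb.exists
    exact hk.trans (hbound k)

end FractionalSobolev
end

noncomputable section

namespace CRSphere

/-! ### Total volume, and the balls of a CR distance -/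

theorem vol_ne_zero (n : ℕ) : vol n ≠ 0 := by
  obtain ⟨ξ⟩ : Nonempty (Sph n) := (NormedSpace.sphere_nonempty.2 zero_le_one).to_subtype
  intro h
  have := vol_ge_of_koranyi ξ one_pos le_rfl MeasurableSet.univ fun _ _ _ => mem_univ _
  rw [h] at this
  have hb : 0 < volume (Metric.ball (0 : Amb n) (1 / 8)) :=
    Metric.measure_ball_pos _ _ (by norm_num)
  simp at this
  exact hb.ne' (by simpa using this)

theorem omega_pos (n : ℕ) : 0 < omega n := by
  refine ENNReal.toReal_pos ?_ (measure_ne_top _ _)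
  simpa using vol_ne_zero n

theorem IsCRDistance.eq_of_eq_zero {n : ℕ} {d : Sph n → Sph n → ℝ} (hd : IsCRDistance n d)
    {ξ η : Sph n} (h : d ξ η = 0) : ξ = η := by
  obtain ⟨c, C, hc, -, hcomp⟩ := hd.comparable
  by_contra hne
  have := (hcomp ξ η).1
  rw [h, ENNReal.ofReal_zero, nonpos_iff_eq_zero, mul_eq_zero] at this
  rcases this with h | h
  · exact hc.not_ge (ENNReal.ofReal_eq_zero.1 h)
  · exact (ccDist_pos hne).ne' h

theorem IsCRDistance.exists_bound {n : ℕ} {d : Sph n → Sph n → ℝ} (hd : IsCRDistance n d) :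
    ∃ M : ℝ, ∀ ξ η, d ξ η ≤ M := by
  obtain ⟨M, hM⟩ := (isCompact_univ.image hd.continuous).bddAbove
  exact ⟨M, fun ξ η => hM ⟨(ξ, η), mem_univ _, rfl⟩⟩

theorem IsCRDistance.exists_ball_volume_ge {n : ℕ} (hn : 1 ≤ n) {d : Sph n → Sph n → ℝ}
    (hd : IsCRDistance n d) : ∃ c C : ℝ, 0 < c ∧ 0 < C ∧ ∀ η, ∀ r : ℝ, 0 < r → r ≤ 1 →
      ENNReal.ofReal (c * r ^ homDim n) ≤ vol n {ξ | d ξ η ≤ C * r} := by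
  obtain ⟨_, C, _, hC, hcomp⟩ := hd.comparable
  have hb : 0 < volume (Metric.ball (0 : Amb n) (1 / 8)) :=
    Metric.measure_ball_pos _ _ (by norm_num)
  have hbt : volume (Metric.ball (0 : Amb n) (1 / 8)) ≠ ∞ := measure_ball_lt_top.ne
  refine ⟨(volume (Metric.ball (0 : Amb n) (1 / 8))).toReal, C * 12, ENNReal.toReal_pos hb.ne' hbt,
    by positivity, fun η r hr0 hr1 => ?_⟩
  have hpow : r ^ homDim n = r ^ (2 * n + 2) := by
    rw [homDim, ← Real.rpow_natCast]; push_cast; rfl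
  rw [hpow, ENNReal.ofReal_mul ENNReal.toReal_nonneg, ENNReal.ofReal_toReal hbt, mul_comm]
  refine vol_ge_of_koranyi η hr0 hr1 ?_ fun ξ h1 h2 => ?_
  · exact (isClosed_le (hd.continuous.comp (by fun_prop : Continuous fun ξ => (ξ, η)))
      continuous_const).measurableSet
  · have h3 := (hcomp η ξ).2.trans
      (mul_le_mul_right (ccDist_le_of_inner hn hr0.le h1 h2) _)
    rw [← ENNReal.ofReal_mul hC.le, ENNReal.ofReal_le_ofReal_iff (by positivity)] at h3
    change d ξ η ≤ _
    rw [hd.symm ξ η]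
    linarith

/-! ### The critical exponent and the optimal coefficient -/

theorem critExp_inv {n : ℕ} {s p : ℝ} (hp : 0 < p) (hsp : s * p < homDim n) :
    1 / critExp n s p = 1 / p - s / homDim n := by
  have hQ : 0 < homDim n := by unfold homDim; positivity
  have : homDim n - s * p ≠ 0 := by linarith
  rw [critExp]
  field_simp

theorem lt_critExp {n : ℕ} {s p : ℝ} (hp : 0 < p) (hs : 0 < s) (hsp : s * p < homDim n) :
    p < critExp n s p := by
  have hQ : 0 < homDim n := by unfold homDim; positivity
  rw [critExp, lt_div_iff₀ (by linarith)]
  nlinarith [mul_pos (mul_pos hs hp) hp]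

theorem lpNorm_const {n : ℕ} {r : ℝ} (hr : 0 < r) (a : ℝ) :
    lpNorm n r (fun _ => a) = |a| * omega n ^ (1 / r) := by
  rw [lpNorm, eLpNorm_const _ (by simpa using hr) (vol_ne_zero n), ENNReal.toReal_mul,
    ENNReal.toReal_ofReal hr.le, ← ENNReal.toReal_rpow, toReal_enorm, Real.norm_eq_abs]
  rfl

/-- Hölder's inequality, with equality for constants; this is why the upper bound for the optimal
`B` matches the test with `u = 1`. -/
theorem abs_average_le {n : ℕ} {p : ℝ} (hp : 1 ≤ p) {u : Sph n → ℝ}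
    (hu : MemLp u (ENNReal.ofReal p) (vol n)) :
    |⨍ ξ, u ξ ∂(vol n)| ≤ omega n ^ (-(1 / p)) * lpNorm n p u := by
  have hp0 : 0 < p := by linarith
  have hω := omega_pos n
  have hωdef : (vol n).real univ = omega n := rfl
  have h1 : |∫ ξ, u ξ ∂(vol n)| ≤ lpNorm n p u * omega n ^ (1 - 1 / p) := by
    have h2 := (enorm_integral_le_lintegral_enorm (μ := vol n) u).trans
      (eLpNorm_one_eq_lintegral_enorm.symm.le.trans
        (eLpNorm_le_eLpNorm_mul_rpow_measure_univ (by simpa using hp : 1 ≤ ENNReal.ofReal p)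
          hu.aestronglyMeasurable))
    rw [ENNReal.toReal_ofReal hp0.le, ENNReal.toReal_one, div_one] at h2
    have hexp : 0 ≤ 1 - 1 / p := by
      rw [sub_nonneg, div_le_one hp0]; exact hp
    have h3 := ENNReal.toReal_mono (ENNReal.mul_ne_top hu.2.ne
      (ENNReal.rpow_ne_top_of_nonneg hexp (measure_ne_top _ _))) h2
    rwa [ENNReal.toReal_mul, ← ENNReal.toReal_rpow, toReal_enorm, Real.norm_eq_abs] at h3
  rw [average_eq, smul_eq_mul, abs_mul, abs_inv, hωdef, abs_of_pos hω, inv_mul_le_iff₀ hω]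
  refine h1.trans_eq ?_
  rw [sub_eq_add_neg, Real.rpow_add hω, Real.rpow_one]
  ring

theorem memHW_one {n : ℕ} {d : Sph n → Sph n → ℝ} {s p : ℝ} (hp : 0 < p) :
    MemHW n d s p (fun _ => 1) ∧ seminorm n d s p (fun _ => 1) = 0 := by
  have : eSeminorm n d s p (fun _ => 1) = 0 := by
    simp [eSeminorm, Real.zero_rpow hp.ne', hp]
  exact ⟨⟨memLp_const _, by rw [this]; exact ENNReal.zero_lt_top⟩, by rw [seminorm, this]; rfl⟩

theorem omega_rpow_le_of_mem_admissibleB {n : ℕ} {d : Sph n → Sph n → ℝ} {s p B : ℝ} (hp : 0 < p)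
    (hs : 0 < s) (hsp : s * p < homDim n) (hB : B ∈ admissibleB n d s p) :
    omega n ^ (-(s / homDim n)) ≤ B := by
  obtain ⟨A, hA⟩ := hB
  have hω := omega_pos n
  have h := (hA _ (memHW_one hp).1).2
  rw [(memHW_one hp).2, mul_zero, zero_add, lpNorm_const hp,
    lpNorm_const (hp.trans (lt_critExp hp hs hsp)), critExp_inv hp hsp, abs_one, one_mul, one_mul,
    sub_eq_add_neg, Real.rpow_add hω, mul_comm] at h
  exact le_of_mul_le_mul_right h (by positivity)

theorem mem_admissibleB_of_omega_rpow_le {n : ℕ} (hn : 1 ≤ n) {d : Sph n → Sph n → ℝ}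
    (hd : IsCRDistance n d) {s p B : ℝ} (hp : 1 < p) (hs : 0 < s) (hsp : s * p < homDim n)
    (hB : omega n ^ (-(s / homDim n)) ≤ B) : B ∈ admissibleB n d s p := by
  have hp0 : 0 < p := by linarith
  have hω := omega_pos n
  have hpq := lt_critExp hp0 hs hsp
  have hq := critExp_inv hp0 hsp
  obtain ⟨M, hM⟩ := hd.exists_bound
  obtain ⟨c, C, hc, hC, hball⟩ := hd.exists_ball_volume_ge hn
  obtain ⟨A, hA, hAu⟩ := FractionalSobolev.exists_eLpNorm_sub_average_le (vol_ne_zero n)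
    (Q := homDim n) (by unfold homDim; positivity) hs hp hpq hq hd.nonneg
    (fun ξ η h => hd.eq_of_eq_zero h) hM
    (fun η => (hd.continuous.comp (by fun_prop : Continuous fun ξ => (ξ, η))).measurable) hc hC
    hball
  refine ⟨A, fun u hu => ?_⟩
  set q := critExp n s p
  have hq0 : 0 < q := hp0.trans hpq
  set m := ⨍ ξ, u ξ ∂(vol n) with hm
  have hw := hAu u hu.1
  have hfin : ENNReal.ofReal A * eSeminorm n d s p u ≠ ∞ :=
    ENNReal.mul_ne_top ENNReal.ofReal_ne_top hu.2.ne
  have hwmem : MemLp (fun η => u η - m) (ENNReal.ofReal q) (vol n) :=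
    ⟨hu.1.aestronglyMeasurable.sub aestronglyMeasurable_const,
      lt_of_le_of_lt hw (lt_top_iff_ne_top.2 hfin)⟩
  have hmmem : MemLp (fun _ : Sph n => m) (ENNReal.ofReal q) (vol n) := memLp_const _
  have hsplit : u = (fun η => u η - m) + fun _ => m := by ext; simp
  have humem : MemLp u (ENNReal.ofReal q) (vol n) := by
    rw [hsplit]; exact hwmem.add hmmem
  refine ⟨humem, ?_⟩
  have h1 : lpNorm n q u ≤ lpNorm n q (fun η => u η - m) + lpNorm n q fun _ => m := by
    rw [lpNorm, lpNorm, lpNorm, ← ENNReal.toReal_add hwmem.2.ne hmmem.2.ne]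
    refine ENNReal.toReal_mono (ENNReal.add_ne_top.2 ⟨hwmem.2.ne, hmmem.2.ne⟩) ?_
    conv_lhs => rw [hsplit]
    exact eLpNorm_add_le hwmem.1 hmmem.1 (by simpa using (hp.trans hpq).le)
  have h2 : lpNorm n q (fun η => u η - m) ≤ A * seminorm n d s p u := by
    have := ENNReal.toReal_mono hfin hw
    rwa [ENNReal.toReal_mul, ENNReal.toReal_ofReal hA] at this
  have h3 : lpNorm n q (fun _ => m) ≤ B * lpNorm n p u := by
    rw [lpNorm_const hq0, hq]
    -- The powers `ω^(-1/p)` from Hölder and `ω^(1/q)` from the norm of a constant combine to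
    -- `ω^(-s/Q)`.
    calc _ ≤ omega n ^ (-(1 / p)) * lpNorm n p u * omega n ^ (1 / p - s / homDim n) :=
          mul_le_mul_of_nonneg_right (abs_average_le hp.le hu.1) (by positivity)
      _ = omega n ^ (-(s / homDim n)) * lpNorm n p u := by
          rw [mul_right_comm, ← Real.rpow_add hω]; congr 2; ring
      _ ≤ _ := mul_le_mul_of_nonneg_right hB ENNReal.toReal_nonneg
  linarith

end CRSphere
end

theorem theorem1p1 (n : ℕ) (hn : 1 ≤ n) (d : CRSphere.Sph n → CRSphere.Sph n → ℝ)
    (hd : CRSphere.IsCRDistance n d) (p s : ℝ) (hp : 1 < p) (hpQ : p < CRSphere.homDim n)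
    (hs0 : 0 < s) (hs1 : s < 1) :
    CRSphere.admissibleB n d s p =
        Set.Ici (CRSphere.omega n ^ (-(s / CRSphere.homDim n))) ∧
      IsClosed (CRSphere.admissibleB n d s p) ∧
      IsLeast (CRSphere.admissibleB n d s p)
        (CRSphere.omega n ^ (-(s / CRSphere.homDim n))) := by
  have hsp : s * p < CRSphere.homDim n := by nlinarith
  have h : CRSphere.admissibleB n d s p =
      Set.Ici (CRSphere.omega n ^ (-(s / CRSphere.homDim n))) :=
    Set.Subset.antisymm
      (fun B hB => CRSphere.omega_rpow_le_of_mem_admissibleB (by linarith) hs0 hsp hB)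
      (fun B hB => CRSphere.mem_admissibleB_of_omega_rpow_le hn hd hp hs0 hsp hB)
  exact ⟨h, h ▸ isClosed_Ici, h ▸ isLeast_Ici⟩
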